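/- Let $n\ge 2$, let $\Omega\subset\mathbb{R}^n$ be a bounded open set (for instance a bounded domain with smooth boundary; no connectedness or boundary regularity is needed), let $\omega\subset\Omega$ be open, let $d>0$, and put $a(x)=d\,\mathbb{1}_\omega(x)$. All functions are complex-valued. Let $H^1_0(\Omega)$ be the closure of $C_c^\infty(\Omega)$ in $H^1(\Omega)$, and let $\mathcal{H}=H^1_0(\Omega)\times L^2(\Omega)$ be the energy space with the inner product $$\langle (u_1,v_1),(u_2,v_2)\rangle=\int_\Omega \nabla u_1\cdot\nabla\overline{u_2}\,dx+\int_\Omega v_1\overline{v_2}\,dx .$$ Define the unbounded operator $\mathcal{A}$ on $\mathcal{H}$ by $$\mathcal{D}(\mathcal{A})=\{(u,v)\in\mathcal{H}:\ v\in H^1_0(\Omega),\ \Delta u+\operatorname{div}(a\nabla v)\in L^2(\Omega)\},\qquad \mathcal{A}(u,v)=\bigl(v,\ \Delta u+\operatorname{div}(a\nabla v)\bigr),$$ where $\Delta u+\operatorname{div}(a\nabla v)$ is understood in the sense of distributions in $\Omega$. **Theorem.** The operator $\mathcal{A}$ generates a $C_0$-semigroup of contractions on $\mathcal{H}$: there is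 a strongly continuous semigroup $(T(t))_{t\ge 0}$ of bounded linear operators on $\mathcal{H}$ with $\|T(t)\|\le 1$ for all $t\ge 0$ whose infinitesimal generator is exactly $(\mathcal{A},\mathcal{D}(\mathcal{A}))$. -/

import Mathlib

open MeasureTheory Filter Topology TopologicalSpace
open scoped Distributions NNReal ENNReal

noncomputable section

namespace KelvinVoigt

variable {n : ℕ}

/-- The complex Lebesgue space `L²(Ω)`. -/
abbrev L2 (Ω : Opens (EuclideanSpace ℝ (Fin n))) : Type :=
  Lp ℂ 2 (volume.restrict (Ω : Set (EuclideanSpace ℝ (Fin n))))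

/-- The space `L²(Ω)ⁿ` of square integrable complex vector fields. -/
abbrev L2Vec (Ω : Opens (EuclideanSpace ℝ (Fin n))) : Type :=
  Lp (EuclideanSpace ℂ (Fin n)) 2 (volume.restrict (Ω : Set (EuclideanSpace ℝ (Fin n))))

/-- The classical gradient `(∂₁φ, …, ∂ₙφ)` of a complex-valued function. -/
def grad (φ : EuclideanSpace ℝ (Fin n) → ℂ) (x : EuclideanSpace ℝ (Fin n)) :
    EuclideanSpace ℂ (Fin n) :=
  WithLp.toLp 2 fun i => fderiv ℝ φ x (EuclideanSpace.single i 1)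

/-- `g` is the weak gradient of `u` in `Ω`:
`∫_Ω u ∂ᵢφ = -∫_Ω gᵢ φ` for all test functions `φ` in `Ω` and all `i`. -/
def HasWeakGradient (Ω : Opens (EuclideanSpace ℝ (Fin n)))
    (u : EuclideanSpace ℝ (Fin n) → ℂ)
    (g : EuclideanSpace ℝ (Fin n) → EuclideanSpace ℂ (Fin n)) : Prop :=
  ∀ (φ : 𝓓(Ω, ℂ)) (i : Fin n),
    ∫ x in (Ω : Set (EuclideanSpace ℝ (Fin n))), u x * grad φ x i =
      -∫ x in (Ω : Set (EuclideanSpace ℝ (Fin n))), g x i * φ x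

/-- `div F = h` in the sense of distributions in `Ω`:
`∫_Ω F · ∇φ = -∫_Ω h φ` for all test functions `φ` in `Ω`. -/
def HasWeakDivergence (Ω : Opens (EuclideanSpace ℝ (Fin n)))
    (F : EuclideanSpace ℝ (Fin n) → EuclideanSpace ℂ (Fin n))
    (h : EuclideanSpace ℝ (Fin n) → ℂ) : Prop :=
  ∀ φ : 𝓓(Ω, ℂ),
    ∫ x in (Ω : Set (EuclideanSpace ℝ (Fin n))), ∑ i, F x i * grad φ x i =
      -∫ x in (Ω : Set (EuclideanSpace ℝ (Fin n))), h x * φ x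

/-! ### Elementary facts on test functions -/

variable {Ω : Opens (EuclideanSpace ℝ (Fin n))}

lemma testFunction_differentiable (φ : 𝓓(Ω, ℂ)) : Differentiable ℝ φ :=
  φ.contDiff.differentiable (by simp)

lemma grad_add (φ ψ : 𝓓(Ω, ℂ)) (x : EuclideanSpace ℝ (Fin n)) :
    grad (⇑(φ + ψ)) x = grad φ x + grad ψ x := by
  have h : (⇑(φ + ψ) : EuclideanSpace ℝ (Fin n) → ℂ) = ⇑φ + ⇑ψ := rfl
  ext i
  simp only [grad, h, PiLp.add_apply]
  rw [fderiv_add (testFunction_differentiable φ x) (testFunction_differentiable ψ x)]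
  rfl

lemma grad_smul (c : ℂ) (φ : 𝓓(Ω, ℂ)) (x : EuclideanSpace ℝ (Fin n)) :
    grad (⇑(c • φ)) x = c • grad φ x := by
  have h : (⇑(c • φ) : EuclideanSpace ℝ (Fin n) → ℂ) = c • ⇑φ := rfl
  ext i
  simp only [grad, h, PiLp.smul_apply]
  rw [fderiv_const_smul (testFunction_differentiable φ x) c]
  rfl

lemma grad_zero (x : EuclideanSpace ℝ (Fin n)) :
    grad (⇑(0 : 𝓓(Ω, ℂ))) x = 0 := by
  have h : (⇑(0 : 𝓓(Ω, ℂ)) : EuclideanSpace ℝ (Fin n) → ℂ) = fun _ => 0 := rfl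
  ext i
  simp [grad, h]

/-- Multiplying by a test function, as an inner product in `L²(Ω)`. -/
lemma exists_inner_eq_integral_mul {f : EuclideanSpace ℝ (Fin n) → ℂ} (hf : Continuous f)
    (hc : HasCompactSupport f) :
    ∃ m : L2 Ω, ∀ u : L2 Ω, inner ℂ m u =
      ∫ x in (Ω : Set (EuclideanSpace ℝ (Fin n))), u x * f x := by
  have hm : MemLp (fun x => (starRingEnd ℂ) (f x)) 2
      (volume.restrict (Ω : Set (EuclideanSpace ℝ (Fin n)))) :=
    ((Complex.continuous_conj.comp hf).memLp_of_hasCompactSupport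
      (hc.comp_left (g := starRingEnd ℂ) (map_zero _))).restrict _
  refine ⟨hm.toLp, fun u => ?_⟩
  rw [L2.inner_def]
  refine integral_congr_ae ?_
  filter_upwards [hm.coeFn_toLp] with x hx
  rw [hx]
  simp

lemma exists_inner_eq_integral_coord_mul {f : EuclideanSpace ℝ (Fin n) → ℂ} (hf : Continuous f)
    (hc : HasCompactSupport f) (i : Fin n) :
    ∃ m : L2Vec Ω, ∀ g : L2Vec Ω, inner ℂ m g =
      ∫ x in (Ω : Set (EuclideanSpace ℝ (Fin n))), g x i * f x := by
  have hm : MemLp (fun x => EuclideanSpace.single i ((starRingEnd ℂ) (f x))) 2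
      (volume.restrict (Ω : Set (EuclideanSpace ℝ (Fin n)))) := by
    refine MemLp.restrict _ (Continuous.memLp_of_hasCompactSupport ?_ ?_)
    · exact (PiLp.continuous_toLp 2 _).comp
        ((continuous_single i).comp (Complex.continuous_conj.comp hf))
    · exact hc.comp_left (g := fun z => EuclideanSpace.single i ((starRingEnd ℂ) z)) (by simp)
  refine ⟨hm.toLp, fun u => ?_⟩
  rw [L2.inner_def]
  refine integral_congr_ae ?_
  filter_upwards [hm.coeFn_toLp] with x hx
  rw [hx]
  simp [EuclideanSpace.inner_single_left, mul_comm]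

lemma continuous_grad_apply (φ : 𝓓(Ω, ℂ)) (i : Fin n) : Continuous fun x => grad φ x i :=
  (φ.contDiff.continuous_fderiv (by simp)).clm_apply continuous_const

lemma hasCompactSupport_grad_apply (φ : 𝓓(Ω, ℂ)) (i : Fin n) :
    HasCompactSupport fun x => grad φ x i :=
  φ.hasCompactSupport.fderiv_apply ℝ (EuclideanSpace.single i 1)

/-- Integration by parts for two test functions. -/
lemma integral_mul_grad (φ ψ : 𝓓(Ω, ℂ)) (i : Fin n) :
    ∫ x in (Ω : Set (EuclideanSpace ℝ (Fin n))), φ x * grad ψ x i =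
      -∫ x in (Ω : Set (EuclideanSpace ℝ (Fin n))), grad φ x i * ψ x := by
  have h0 : ∀ x, x ∉ (Ω : Set (EuclideanSpace ℝ (Fin n))) → φ x = 0 := fun x hx =>
    image_eq_zero_of_notMem_tsupport fun h => hx (φ.tsupport_subset h)
  have h1 : ∀ x, x ∉ (Ω : Set (EuclideanSpace ℝ (Fin n))) → ψ x = 0 := fun x hx =>
    image_eq_zero_of_notMem_tsupport fun h => hx (ψ.tsupport_subset h)
  rw [setIntegral_eq_integral_of_forall_compl_eq_zero (fun x hx => by rw [h0 x hx, zero_mul]),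
    setIntegral_eq_integral_of_forall_compl_eq_zero (fun x hx => by rw [h1 x hx, mul_zero])]
  refine integral_mul_fderiv_eq_neg_fderiv_mul_of_integrable ?_ ?_ ?_
    (fun x _ => testFunction_differentiable φ x) (fun x _ => testFunction_differentiable ψ x)
  · exact (((continuous_grad_apply φ i).mul ψ.continuous).integrable_of_hasCompactSupport
      (ψ.hasCompactSupport.mul_left))
  · exact ((φ.continuous.mul (continuous_grad_apply ψ i)).integrable_of_hasCompactSupport
      (φ.hasCompactSupport.mul_right))
  · exact ((φ.continuous.mul ψ.continuous).integrable_of_hasCompactSupport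
      (φ.hasCompactSupport.mul_right))

/-- A square integrable function that vanishes against all test functions is zero. -/
lemma ae_eq_zero_of_integral_mul_test {f : EuclideanSpace ℝ (Fin n) → ℂ}
    (hf : MemLp f 2 (volume.restrict (Ω : Set (EuclideanSpace ℝ (Fin n)))))
    (h : ∀ φ : 𝓓(Ω, ℂ), ∫ x in (Ω : Set (EuclideanSpace ℝ (Fin n))), f x * φ x = 0) :
    f =ᵐ[volume.restrict (Ω : Set (EuclideanSpace ℝ (Fin n)))] 0 := by
  have hloc : LocallyIntegrableOn f (Ω : Set (EuclideanSpace ℝ (Fin n))) :=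
    locallyIntegrableOn_of_locallyIntegrable_restrict (hf.locallyIntegrable (by norm_num))
  have := Ω.isOpen.ae_eq_zero_of_integral_contDiff_smul_eq_zero hloc (fun g hg hgc hgs => by
    have hs : tsupport (fun x => (g x : ℂ)) ⊆ tsupport g :=
      closure_mono (fun x hx => by simpa using hx)
    let φ : 𝓓(Ω, ℂ) := ⟨fun x => (g x : ℂ), Complex.ofRealCLM.contDiff.comp hg,
      hgc.comp_left (g := fun r : ℝ => (r : ℂ)) (by simp), hs.trans hgs⟩
    have h2 := h φ
    rw [setIntegral_eq_integral_of_forall_compl_eq_zero] at h2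
    · rw [← h2]
      refine integral_congr_ae (ae_of_all _ fun x => ?_)
      change g x • f x = f x * (g x : ℂ)
      rw [Complex.real_smul, mul_comm]
    · intro x hx
      have : φ x = 0 := image_eq_zero_of_notMem_tsupport fun h => hx (φ.tsupport_subset h)
      rw [this, mul_zero])
  rw [Filter.EventuallyEq, ae_restrict_iff' Ω.isOpen.measurableSet]
  exact this

/-! ### The space `H¹₀(Ω)` -/

variable (Ω) in
/-- The pairs `(φ, ∇φ)` in `L²(Ω) × L²(Ω)ⁿ`, where `φ` is a smooth function with compact support
in `Ω`. -/
def testGraph : Submodule ℂ (L2 Ω × L2Vec Ω) where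
  carrier := {p | ∃ φ : 𝓓(Ω, ℂ),
    p.1 =ᵐ[volume.restrict (Ω : Set (EuclideanSpace ℝ (Fin n)))] φ ∧
    p.2 =ᵐ[volume.restrict (Ω : Set (EuclideanSpace ℝ (Fin n)))] grad φ}
  zero_mem' := by
    refine ⟨0, Lp.coeFn_zero _ _ _, ?_⟩
    filter_upwards [Lp.coeFn_zero (EuclideanSpace ℂ (Fin n)) 2
      (volume.restrict (Ω : Set (EuclideanSpace ℝ (Fin n))))] with x hx
    rw [grad_zero]
    exact hx
  add_mem' := by
    rintro p q ⟨φ, h1, h2⟩ ⟨ψ, h3, h4⟩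
    refine ⟨φ + ψ, ?_, ?_⟩
    · filter_upwards [Lp.coeFn_add p.1 q.1, h1, h3] with x hx h1 h3
      exact hx.trans (congrArg₂ (· + ·) h1 h3)
    · filter_upwards [Lp.coeFn_add p.2 q.2, h2, h4] with x hx h2 h4
      rw [grad_add, ← h2, ← h4]
      exact hx
  smul_mem' := by
    rintro c p ⟨φ, h1, h2⟩
    refine ⟨c • φ, ?_, ?_⟩
    · filter_upwards [Lp.coeFn_smul c p.1, h1] with x hx h1
      exact hx.trans (congrArg (c • ·) h1)
    · filter_upwards [Lp.coeFn_smul c p.2, h2] with x hx h2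
      rw [grad_smul, ← h2]
      exact hx

variable (Ω) in
/-- The Sobolev space `H¹₀(Ω)`: the closure of `C_c^∞(Ω)` for the `H¹`-norm. A function
`u ∈ H¹₀(Ω)` is stored as the pair `(u, ∇u) ∈ L²(Ω) × L²(Ω)ⁿ`; the second component is the weak
gradient of the first one, and so it is determined by it (see `H10.hasWeakGradient` and
`H10.toL2_injective`). -/
def H10 : Type := (testGraph Ω).topologicalClosure

namespace H10

instance : AddCommGroup (H10 Ω) := inferInstanceAs (AddCommGroup (testGraph Ω).topologicalClosure)

instance : Module ℂ (H10 Ω) := inferInstanceAs (Module ℂ (testGraph Ω).topologicalClosure)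

variable (Ω) in
/-- The inclusion `H¹₀(Ω) → L²(Ω)`. -/
def toL2 : H10 Ω →ₗ[ℂ] L2 Ω :=
  LinearMap.fst ℂ (L2 Ω) (L2Vec Ω) ∘ₗ (testGraph Ω).topologicalClosure.subtype

variable (Ω) in
/-- The weak gradient `∇ : H¹₀(Ω) → L²(Ω)ⁿ`. -/
def gradient : H10 Ω →ₗ[ℂ] L2Vec Ω :=
  LinearMap.snd ℂ (L2 Ω) (L2Vec Ω) ∘ₗ (testGraph Ω).topologicalClosure.subtype

lemma ext_pair {u v : H10 Ω} (h1 : toL2 Ω u = toL2 Ω v) (h2 : gradient Ω u = gradient Ω v) :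
    u = v :=
  Subtype.ext (Prod.ext h1 h2)

lemma mem_closure (u : H10 Ω) :
    (toL2 Ω u, gradient Ω u) ∈ closure (testGraph Ω : Set (L2 Ω × L2Vec Ω)) :=
  u.2

lemma hasWeakGradient (u : H10 Ω) : HasWeakGradient Ω (toL2 Ω u) (gradient Ω u) := by
  intro ψ i
  obtain ⟨m, hm⟩ := exists_inner_eq_integral_mul (Ω := Ω) (continuous_grad_apply ψ i)
    (hasCompactSupport_grad_apply ψ i)
  obtain ⟨k, hk⟩ := exists_inner_eq_integral_coord_mul (Ω := Ω) ψ.continuous ψ.hasCompactSupport i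
  rw [← hm, ← hk]
  have hcl : IsClosed {p : L2 Ω × L2Vec Ω | inner ℂ m p.1 = -inner ℂ k p.2} :=
    isClosed_eq (by fun_prop) (by fun_prop)
  refine closure_minimal ?_ hcl (mem_closure u)
  rintro p ⟨φ, h1, h2⟩
  change inner ℂ m p.1 = -inner ℂ k p.2
  rw [hm, hk]
  refine Eq.trans (integral_congr_ae ?_) ((integral_mul_grad φ ψ i).trans
    (congrArg Neg.neg (integral_congr_ae ?_)))
  · filter_upwards [h1] with x hx
    rw [hx]
  · filter_upwards [h2] with x hx
    rw [hx]

lemma gradient_eq_zero {u : H10 Ω} (hu : toL2 Ω u = 0) : gradient Ω u = 0 := by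
  have hw := hasWeakGradient u
  have hcoord : ∀ i : Fin n, (fun x => gradient Ω u x i)
      =ᵐ[volume.restrict (Ω : Set (EuclideanSpace ℝ (Fin n)))] 0 := by
    intro i
    refine ae_eq_zero_of_integral_mul_test ?_ fun φ => ?_
    · exact (EuclideanSpace.proj (𝕜 := ℂ) i).comp_memLp' (Lp.memLp (gradient Ω u))
    · have h := hw φ i
      rw [eq_comm, neg_eq_iff_eq_neg] at h
      rw [h, neg_eq_zero]
      refine integral_eq_zero_of_ae ?_
      rw [hu]
      filter_upwards [Lp.coeFn_zero ℂ 2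
        (volume.restrict (Ω : Set (EuclideanSpace ℝ (Fin n))))] with x hx
      change (0 : L2 Ω) x * grad φ x i = 0
      rw [hx, Pi.zero_apply, zero_mul]
  rw [Lp.eq_zero_iff_ae_eq_zero]
  filter_upwards [ae_all_iff.2 hcoord] with x hx
  ext i
  exact hx i

lemma toL2_injective : Function.Injective (toL2 Ω) := by
  rw [injective_iff_map_eq_zero]
  intro u hu
  refine ext_pair ?_ ?_
  · rw [hu, map_zero]
  · rw [gradient_eq_zero hu, map_zero]

/-! ### Poincaré's inequality, which makes `‖∇u‖` a norm on `H¹₀(Ω)` -/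

lemma norm_fderiv_le (φ : EuclideanSpace ℝ (Fin n) → ℂ) (x : EuclideanSpace ℝ (Fin n)) :
    ‖fderiv ℝ φ x‖ ≤ n * ‖grad φ x‖ := by
  refine ContinuousLinearMap.opNorm_le_bound _ (by positivity) fun v => ?_
  have hv : v = ∑ i, v i • EuclideanSpace.single i (1 : ℝ) := by
    ext j
    simp [Finset.sum_apply, Pi.single_apply]
  have h1 : fderiv ℝ φ x v = ∑ i, v i • grad φ x i := by
    conv_lhs => rw [hv]
    simp [map_sum, grad]
  rw [h1]
  calc ‖∑ i, v i • grad φ x i‖ ≤ ∑ _i : Fin n, ‖v‖ * ‖grad φ x‖ := by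
        refine norm_sum_le_of_le _ fun i _ => ?_
        rw [norm_smul]
        exact mul_le_mul (PiLp.norm_apply_le v i) (PiLp.norm_apply_le _ i) (norm_nonneg _)
          (norm_nonneg _)
    _ = n * ‖grad φ x‖ * ‖v‖ := by
        simp
        ring

lemma eLpNorm_fderiv_restrict (φ : 𝓓(Ω, ℂ)) (p : ℝ≥0∞) :
    eLpNorm (fderiv ℝ φ) p (volume.restrict (Ω : Set (EuclideanSpace ℝ (Fin n)))) =
      eLpNorm (fderiv ℝ φ) p volume := by
  rw [← eLpNorm_norm (fderiv ℝ φ), ← eLpNorm_norm (fderiv ℝ φ)]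
  refine eLpNorm_restrict_eq_of_support_subset fun x hx => φ.tsupport_subset ?_
  refine support_fderiv_subset ℝ fun h => hx ?_
  simp [h]

lemma exists_poincare [Fact (2 ≤ n)]
    [hb : Fact (Bornology.IsBounded (Ω : Set (EuclideanSpace ℝ (Fin n))))] :
    ∃ C : ℝ≥0, ∀ u : H10 Ω, ‖toL2 Ω u‖ ≤ C * ‖gradient Ω u‖ := by
  have h2 : 2 ≤ n := Fact.out
  have h2r : (2 : ℝ) ≤ n := by exact_mod_cast h2
  set s : Set (EuclideanSpace ℝ (Fin n)) := (Ω : Set (EuclideanSpace ℝ (Fin n))) with hs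
  have : IsFiniteMeasure (volume.restrict s) := ⟨by
    rw [Measure.restrict_apply_univ]; exact hb.out.measure_lt_top⟩
  obtain ⟨p, hp⟩ : ∃ p : ℝ≥0, (p : ℝ) = 2 * n / (n + 2) :=
    ⟨⟨2 * n / (n + 2), by positivity⟩, rfl⟩
  have hp1 : 1 ≤ p := by
    rw [← NNReal.coe_le_coe, hp, NNReal.coe_one, le_div_iff₀ (by positivity)]
    linarith
  have hpn : p < Module.finrank ℝ (EuclideanSpace ℝ (Fin n)) := by
    rw [finrank_euclideanSpace_fin, ← NNReal.coe_lt_coe, hp, NNReal.coe_natCast,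
      div_lt_iff₀ (by positivity)]
    nlinarith
  have hp2 : p ≤ 2 := by
    rw [← NNReal.coe_le_coe, hp, div_le_iff₀ (by positivity)]
    push_cast
    linarith
  have hpq : (p : ℝ)⁻¹ - (Module.finrank ℝ (EuclideanSpace ℝ (Fin n)) : ℝ)⁻¹
      ≤ ((2 : ℝ≥0) : ℝ)⁻¹ := by
    rw [finrank_euclideanSpace_fin, hp]
    refine le_of_eq ?_
    have : (n : ℝ) ≠ 0 := by positivity
    push_cast
    field_simp
    ring
  obtain ⟨K, hK⟩ : ∃ K : ℝ≥0, ∀ φ : 𝓓(Ω, ℂ),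
      eLpNorm φ 2 volume ≤ K * eLpNorm (fderiv ℝ φ) p volume :=
    ⟨_, fun φ => eLpNorm_le_eLpNorm_fderiv_of_le volume (q := 2) (φ.contDiff.of_le (by simp))
      ((subset_tsupport _).trans φ.tsupport_subset) hp1 hpn hpq hb.out⟩
  obtain ⟨M, hM⟩ : ∃ M : ℝ≥0, ∀ f : EuclideanSpace ℝ (Fin n) →
      (EuclideanSpace ℝ (Fin n) →L[ℝ] ℂ), AEStronglyMeasurable f (volume.restrict s) →
      eLpNorm f p (volume.restrict s) ≤ eLpNorm f 2 (volume.restrict s) * M := by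
    have hexp : 0 ≤ 1 / (p : ℝ≥0∞).toReal - 1 / (2 : ℝ≥0∞).toReal := by
      have h3 : (0 : ℝ) < p := by exact_mod_cast (zero_lt_one.trans_le hp1)
      have h4 : (p : ℝ) ≤ 2 := by exact_mod_cast hp2
      have := one_div_le_one_div_of_le h3 h4
      simp only [ENNReal.coe_toReal, ENNReal.toReal_ofNat]
      linarith
    have hp2' : (p : ℝ≥0∞) ≤ 2 := by exact_mod_cast hp2
    refine ⟨(volume.restrict s Set.univ ^
      (1 / (p : ℝ≥0∞).toReal - 1 / (2 : ℝ≥0∞).toReal)).toNNReal, fun f hf =>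
      (eLpNorm_le_eLpNorm_mul_rpow_measure_univ hp2' hf).trans (le_of_eq ?_)⟩
    rw [ENNReal.coe_toNNReal (ENNReal.rpow_ne_top_of_nonneg hexp (measure_ne_top _ _))]
  refine ⟨K * (n * M), fun u => ?_⟩
  have hcl : IsClosed {q : L2 Ω × L2Vec Ω | ‖q.1‖ ≤ (K * (n * M) : ℝ≥0) * ‖q.2‖} :=
    isClosed_le (by fun_prop) (by fun_prop)
  refine closure_minimal ?_ hcl (mem_closure u)
  rintro q ⟨φ, h1, h2⟩
  have hmain : eLpNorm q.1 2 (volume.restrict s) ≤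
      ((K * (n * M) : ℝ≥0) : ℝ≥0∞) * eLpNorm q.2 2 (volume.restrict s) := by
    rw [eLpNorm_congr_ae h1, eLpNorm_congr_ae h2]
    calc eLpNorm φ 2 (volume.restrict s) ≤ eLpNorm φ 2 volume :=
          eLpNorm_mono_measure _ Measure.restrict_le_self
      _ ≤ K * eLpNorm (fderiv ℝ φ) p volume := hK φ
      _ = K * eLpNorm (fderiv ℝ φ) p (volume.restrict s) := by
          rw [eLpNorm_fderiv_restrict]
      _ ≤ K * (eLpNorm (fderiv ℝ φ) 2 (volume.restrict s) * M) := by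
          gcongr
          exact hM _ (φ.contDiff.continuous_fderiv (by simp)).aestronglyMeasurable
      _ ≤ K * (((n : ℝ≥0) • eLpNorm (grad φ) 2 (volume.restrict s)) * M) := by
          gcongr
          refine eLpNorm_le_nnreal_smul_eLpNorm_of_ae_le_mul (ae_of_all _ fun x => ?_) 2
          exact_mod_cast norm_fderiv_le φ x
      _ = ((K * (n * M) : ℝ≥0) : ℝ≥0∞) * eLpNorm (grad φ) 2 (volume.restrict s) := by
          rw [ENNReal.smul_def, smul_eq_mul]
          push_cast
          ring
  change ‖q.1‖ ≤ (K * (n * M) : ℝ≥0) * ‖q.2‖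
  have h3 := ENNReal.toReal_mono
    (ENNReal.mul_ne_top ENNReal.coe_ne_top (Lp.eLpNorm_ne_top q.2)) hmain
  rw [ENNReal.toReal_mul, ENNReal.coe_toReal] at h3
  rwa [Lp.norm_def, Lp.norm_def]

lemma gradient_injective [Fact (2 ≤ n)]
    [Fact (Bornology.IsBounded (Ω : Set (EuclideanSpace ℝ (Fin n))))] :
    Function.Injective (gradient Ω) := by
  rw [injective_iff_map_eq_zero]
  intro u hu
  obtain ⟨C, hC⟩ := exists_poincare (Ω := Ω)
  have h := hC u
  rw [hu, norm_zero, mul_zero, norm_le_zero_iff] at h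
  exact toL2_injective (by rw [h, map_zero])

/-- `H¹₀(Ω)` carries the norm `‖∇u‖_{L²}`. -/
instance [Fact (2 ≤ n)] [Fact (Bornology.IsBounded (Ω : Set (EuclideanSpace ℝ (Fin n))))] :
    NormedAddCommGroup (H10 Ω) :=
  NormedAddCommGroup.induced (H10 Ω) (L2Vec Ω) (gradient Ω) gradient_injective

/-- `H¹₀(Ω)` carries the inner product `∫_Ω ∇u₁ · ∇u₂`, conjugated in one factor. -/
instance [Fact (2 ≤ n)] [Fact (Bornology.IsBounded (Ω : Set (EuclideanSpace ℝ (Fin n))))] :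
    InnerProductSpace ℂ (H10 Ω) where
  norm_smul_le c u := by
    change ‖gradient Ω (c • u)‖ ≤ ‖c‖ * ‖gradient Ω u‖
    rw [map_smul, norm_smul]
  inner u v := inner ℂ (gradient Ω u) (gradient Ω v)
  norm_sq_eq_re_inner u := norm_sq_eq_re_inner (𝕜 := ℂ) (gradient Ω u)
  conj_inner_symm u v := inner_conj_symm (gradient Ω u) (gradient Ω v)
  add_left u v w := by rw [map_add, inner_add_left]
  smul_left u v c := by rw [map_smul, inner_smul_left]

end H10

/-! ### The energy space and the operator -/

variable (Ω) in
/-- The energy space `H¹₀(Ω) × L²(Ω)` with the inner product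
`∫_Ω ∇u₁ · ∇u₂ + ∫_Ω v₁ v₂` (conjugated in one factor). -/
abbrev EnergySpace [Fact (2 ≤ n)]
    [Fact (Bornology.IsBounded (Ω : Set (EuclideanSpace ℝ (Fin n))))] : Type :=
  WithLp 2 (H10 Ω × L2 Ω)

/-- The damping coefficient `a = d 𝟙_ω`. -/
def damping (ω : Opens (EuclideanSpace ℝ (Fin n))) (d : ℝ) : EuclideanSpace ℝ (Fin n) → ℝ :=
  (ω : Set (EuclideanSpace ℝ (Fin n))).indicator fun _ => d

/-- `Δu + div(a∇v) = h` in the sense of distributions in `Ω`. Here `Δu = div ∇u`, so this says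
that the vector field `∇u + a∇v ∈ L²(Ω)ⁿ` has distributional divergence `h`. -/
def IsLaplacianAddDiv (a : EuclideanSpace ℝ (Fin n) → ℝ) (u v : H10 Ω) (h : L2 Ω) : Prop :=
  HasWeakDivergence Ω (fun x => H10.gradient Ω u x + (a x : ℂ) • H10.gradient Ω v x) h

lemma memLp_damping_smul (ω : Opens (EuclideanSpace ℝ (Fin n))) (d : ℝ) (g : L2Vec Ω) :
    MemLp (fun x => (damping ω d x : ℂ) • g x) 2
      (volume.restrict (Ω : Set (EuclideanSpace ℝ (Fin n)))) := by
  have h : (fun x => (damping ω d x : ℂ) • g x) =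
      (ω : Set (EuclideanSpace ℝ (Fin n))).indicator ((d : ℂ) • ⇑g) := by
    funext x
    by_cases hx : x ∈ (ω : Set (EuclideanSpace ℝ (Fin n))) <;> simp [damping, hx]
  rw [h]
  exact ((Lp.memLp g).const_smul (d : ℂ)).indicator ω.isOpen.measurableSet

lemma integrable_mul_test {f g : EuclideanSpace ℝ (Fin n) → ℂ}
    (hf : MemLp f 2 (volume.restrict (Ω : Set (EuclideanSpace ℝ (Fin n)))))
    (hg : Continuous g) (hc : HasCompactSupport g) :
    IntegrableOn (fun x => f x * g x) (Ω : Set (EuclideanSpace ℝ (Fin n))) :=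
  hf.integrable_mul (q := 2) ((hg.memLp_of_hasCompactSupport hc).restrict _)

lemma integrable_dot_grad {F : EuclideanSpace ℝ (Fin n) → EuclideanSpace ℂ (Fin n)}
    (hF : MemLp F 2 (volume.restrict (Ω : Set (EuclideanSpace ℝ (Fin n))))) (φ : 𝓓(Ω, ℂ)) :
    IntegrableOn (fun x => ∑ i, F x i * grad φ x i) (Ω : Set (EuclideanSpace ℝ (Fin n))) :=
  integrable_finsetSum _ fun i _ => integrable_mul_test
    ((EuclideanSpace.proj (𝕜 := ℂ) i).comp_memLp' hF) (continuous_grad_apply φ i)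
    (hasCompactSupport_grad_apply φ i)

lemma HasWeakDivergence.congr {F F' : EuclideanSpace ℝ (Fin n) → EuclideanSpace ℂ (Fin n)}
    {h h' : EuclideanSpace ℝ (Fin n) → ℂ} (hd : HasWeakDivergence Ω F h)
    (hF : F' =ᵐ[volume.restrict (Ω : Set (EuclideanSpace ℝ (Fin n)))] F)
    (hh : h' =ᵐ[volume.restrict (Ω : Set (EuclideanSpace ℝ (Fin n)))] h) :
    HasWeakDivergence Ω F' h' := by
  intro φ
  refine Eq.trans (integral_congr_ae ?_) ((hd φ).trans
    (congrArg Neg.neg (integral_congr_ae ?_)))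
  · filter_upwards [hF] with x hx
    rw [hx]
  · filter_upwards [hh] with x hx
    rw [hx]

lemma HasWeakDivergence.add {F F' : EuclideanSpace ℝ (Fin n) → EuclideanSpace ℂ (Fin n)}
    {h h' : EuclideanSpace ℝ (Fin n) → ℂ}
    (hF : MemLp F 2 (volume.restrict (Ω : Set (EuclideanSpace ℝ (Fin n)))))
    (hF' : MemLp F' 2 (volume.restrict (Ω : Set (EuclideanSpace ℝ (Fin n)))))
    (hh : MemLp h 2 (volume.restrict (Ω : Set (EuclideanSpace ℝ (Fin n)))))
    (hh' : MemLp h' 2 (volume.restrict (Ω : Set (EuclideanSpace ℝ (Fin n)))))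
    (hd : HasWeakDivergence Ω F h) (hd' : HasWeakDivergence Ω F' h') :
    HasWeakDivergence Ω (fun x => F x + F' x) (fun x => h x + h' x) := by
  intro φ
  simp only [PiLp.add_apply, add_mul, Finset.sum_add_distrib]
  rw [integral_add (integrable_dot_grad hF φ) (integrable_dot_grad hF' φ), hd φ, hd' φ,
    integral_add (integrable_mul_test hh φ.continuous φ.hasCompactSupport)
      (integrable_mul_test hh' φ.continuous φ.hasCompactSupport), neg_add]

lemma HasWeakDivergence.smul {F : EuclideanSpace ℝ (Fin n) → EuclideanSpace ℂ (Fin n)}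
    {h : EuclideanSpace ℝ (Fin n) → ℂ} (c : ℂ) (hd : HasWeakDivergence Ω F h) :
    HasWeakDivergence Ω (fun x => c • F x) (fun x => c • h x) := by
  intro φ
  simp only [PiLp.smul_apply, smul_eq_mul, mul_assoc, ← Finset.mul_sum]
  rw [integral_const_mul, integral_const_mul, hd φ, mul_neg]

lemma IsLaplacianAddDiv.add {ω : Opens (EuclideanSpace ℝ (Fin n))} {d : ℝ}
    {u v u' v' : H10 Ω} {h h' : L2 Ω} (hd : IsLaplacianAddDiv (damping ω d) u v h)
    (hd' : IsLaplacianAddDiv (damping ω d) u' v' h') :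
    IsLaplacianAddDiv (damping ω d) (u + u') (v + v') (h + h') := by
  refine HasWeakDivergence.congr (HasWeakDivergence.add
    ((Lp.memLp (H10.gradient Ω u)).add (memLp_damping_smul ω d _))
    ((Lp.memLp (H10.gradient Ω u')).add (memLp_damping_smul ω d _))
    (Lp.memLp h) (Lp.memLp h') hd hd') ?_ (Lp.coeFn_add h h')
  rw [map_add, map_add]
  filter_upwards [Lp.coeFn_add (H10.gradient Ω u) (H10.gradient Ω u'),
    Lp.coeFn_add (H10.gradient Ω v) (H10.gradient Ω v')] with x h1 h2
  rw [h1, h2, Pi.add_apply, Pi.add_apply, smul_add]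
  exact add_add_add_comm _ _ _ _

lemma IsLaplacianAddDiv.smul {a : EuclideanSpace ℝ (Fin n) → ℝ} {u v : H10 Ω} {h : L2 Ω} (c : ℂ)
    (hd : IsLaplacianAddDiv a u v h) : IsLaplacianAddDiv a (c • u) (c • v) (c • h) := by
  refine HasWeakDivergence.congr (HasWeakDivergence.smul c hd) ?_ (Lp.coeFn_smul c h)
  rw [map_smul, map_smul]
  filter_upwards [Lp.coeFn_smul c (H10.gradient Ω u),
    Lp.coeFn_smul c (H10.gradient Ω v)] with x h1 h2
  rw [h1, h2, Pi.smul_apply, Pi.smul_apply, smul_add, smul_comm c]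

lemma IsLaplacianAddDiv.zero (a : EuclideanSpace ℝ (Fin n) → ℝ) :
    IsLaplacianAddDiv a (0 : H10 Ω) 0 0 := by
  have h : HasWeakDivergence Ω (fun _ => 0) (fun _ => 0) := fun φ => by simp
  refine h.congr ?_ (Lp.coeFn_zero _ _ _)
  rw [map_zero]
  filter_upwards [Lp.coeFn_zero (EuclideanSpace ℂ (Fin n)) 2
    (volume.restrict (Ω : Set (EuclideanSpace ℝ (Fin n))))] with x hx
  rw [hx, Pi.zero_apply, smul_zero, add_zero]

lemma IsLaplacianAddDiv.unique {a : EuclideanSpace ℝ (Fin n) → ℝ} {u v : H10 Ω} {h k : L2 Ω}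
    (hh : IsLaplacianAddDiv a u v h) (hk : IsLaplacianAddDiv a u v k) : h = k := by
  rw [← sub_eq_zero, Lp.eq_zero_iff_ae_eq_zero]
  refine ae_eq_zero_of_integral_mul_test (Lp.memLp _) fun φ => ?_
  obtain ⟨m, hm⟩ := exists_inner_eq_integral_mul (Ω := Ω) φ.continuous φ.hasCompactSupport
  have h1 := (hh φ).symm.trans (hk φ)
  rw [← hm, ← hm, neg_inj] at h1
  rw [← hm, inner_sub_right, h1, sub_self]

section Operator

variable [Fact (2 ≤ n)] [Fact (Bornology.IsBounded (Ω : Set (EuclideanSpace ℝ (Fin n))))]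

variable (Ω) in
/-- The graph of `A(u, v) = (v, Δu + div(a∇v))`: the pairs `((u, v), (w, h))` in the energy space
with `w = v` (so that `v ∈ H¹₀(Ω)`) and `h = Δu + div(a∇v)` (so that this distribution is in
`L²(Ω)`), where `a = d 𝟙_ω`. -/
def operatorGraph (ω : Opens (EuclideanSpace ℝ (Fin n))) (d : ℝ) :
    Submodule ℂ (EnergySpace Ω × EnergySpace Ω) where
  carrier := {p | H10.toL2 Ω p.2.fst = p.1.snd ∧
    IsLaplacianAddDiv (damping ω d) p.1.fst p.2.fst p.2.snd}
  zero_mem' := ⟨map_zero _, IsLaplacianAddDiv.zero _⟩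
  add_mem' := by
    rintro p q ⟨h1, h2⟩ ⟨h3, h4⟩
    refine ⟨?_, h2.add h4⟩
    change H10.toL2 Ω (p.2.fst + q.2.fst) = p.1.snd + q.1.snd
    rw [map_add, h1, h3]
  smul_mem' := by
    rintro c p ⟨h1, h2⟩
    refine ⟨?_, h2.smul c⟩
    change H10.toL2 Ω (c • p.2.fst) = c • p.1.snd
    rw [map_smul, h1]

variable (Ω) in
/-- The operator `A(u, v) = (v, Δu + div(a∇v))`, `a = d 𝟙_ω`, in the energy space, with domain
`{(u, v) : v ∈ H¹₀(Ω), Δu + div(a∇v) ∈ L²(Ω)}`;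
see `mem_domain_iff` and `operator_apply_eq_iff`. -/
def operator (ω : Opens (EuclideanSpace ℝ (Fin n))) (d : ℝ) : EnergySpace Ω →ₗ.[ℂ] EnergySpace Ω :=
  (operatorGraph Ω ω d).toLinearPMap

lemma operator_graph (ω : Opens (EuclideanSpace ℝ (Fin n))) (d : ℝ) :
    (operator Ω ω d).graph = operatorGraph Ω ω d := by
  refine Submodule.toLinearPMap_graph_eq _ ?_
  rintro ⟨x, y⟩ ⟨h1, h2⟩ hx
  change x = 0 at hx
  subst hx
  have h3 : y.fst = 0 := H10.toL2_injective (h1.trans (map_zero _).symm)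
  change IsLaplacianAddDiv (damping ω d) 0 y.fst y.snd at h2
  rw [h3] at h2
  have h4 : y.snd = 0 := h2.unique (IsLaplacianAddDiv.zero _)
  exact WithLp.ofLp_injective 2 (Prod.ext h3 h4)

/-- `(u, v)` is in the domain iff `v ∈ H¹₀(Ω)` and `Δu + div(a∇v) ∈ L²(Ω)`. -/
lemma mem_domain_iff (ω : Opens (EuclideanSpace ℝ (Fin n))) (d : ℝ) (x : EnergySpace Ω) :
    x ∈ (operator Ω ω d).domain ↔
      ∃ w : H10 Ω, H10.toL2 Ω w = x.snd ∧ ∃ h : L2 Ω, IsLaplacianAddDiv (damping ω d) x.fst w h := by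
  rw [LinearPMap.mem_domain_iff, operator_graph]
  constructor
  · rintro ⟨y, h1, h2⟩
    exact ⟨y.fst, h1, y.snd, h2⟩
  · rintro ⟨w, h1, h, h2⟩
    exact ⟨WithLp.toLp 2 (w, h), h1, h2⟩

/-- `A(u, v) = (w, h)` iff `w = v` and `h = Δu + div(a∇v)`. -/
lemma operator_apply_eq_iff (ω : Opens (EuclideanSpace ℝ (Fin n))) (d : ℝ)
    (x : (operator Ω ω d).domain) (y : EnergySpace Ω) :
    operator Ω ω d x = y ↔ H10.toL2 Ω y.fst = (x : EnergySpace Ω).snd ∧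
      IsLaplacianAddDiv (damping ω d) (x : EnergySpace Ω).fst y.fst y.snd := by
  rw [eq_comm, LinearPMap.image_iff x.2, operator_graph]
  rfl

end Operator

/-! ### Semigroups -/

section Semigroup

variable {H : Type*} [NormedAddCommGroup H] [NormedSpace ℂ H]

/-- `(T t)_{t ≥ 0}` is a `C₀`-semigroup of bounded operators on `H`. -/
structure IsC0Semigroup (T : ℝ≥0 → H →L[ℂ] H) : Prop where
  map_zero : T 0 = ContinuousLinearMap.id ℂ H
  map_add : ∀ s t, T (s + t) = (T s).comp (T t)
  tendsto_zero : ∀ x, Tendsto (fun t => T t x) (𝓝[>] 0) (𝓝 x)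

/-- `(T t)_{t ≥ 0}` is a `C₀`-semigroup of contractions on `H`. -/
structure IsContractionC0Semigroup (T : ℝ≥0 → H →L[ℂ] H) : Prop extends IsC0Semigroup T where
  norm_le_one : ∀ t, ‖T t‖ ≤ 1

/-- `A` is the infinitesimal generator of `(T t)_{t ≥ 0}`: one has `x ∈ D(A)` and `A x = y` if and
only if `(T t x - x) / t` tends to `y` as `t → 0+`. -/
def IsGenerator (A : H →ₗ.[ℂ] H) (T : ℝ≥0 → H →L[ℂ] H) : Prop :=
  ∀ x y : H, (x, y) ∈ A.graph ↔
    Tendsto (fun t : ℝ≥0 => ((t : ℝ) : ℂ)⁻¹ • (T t x - x)) (𝓝[>] 0) (𝓝 y)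

/-- `A` generates a `C₀`-semigroup of contractions on `H`. -/
def GeneratesContractionC0Semigroup (A : H →ₗ.[ℂ] H) : Prop :=
  ∃ T : ℝ≥0 → H →L[ℂ] H, IsContractionC0Semigroup T ∧ IsGenerator A T

end Semigroup

end KelvinVoigt

end

/-! By Lumer–Phillips it suffices that `operator Ω ω d` is dissipative and that `l - A` is onto for
every `l > 0`. Testing `h = Δu + div(a∇v)` with `v` itself gives `Re ⟨A(u,v), (u,v)⟩ = -∫ a|∇v|² ≤
0`, because the cross terms of the wave part cancel in real part. For surjectivity, `l u - v = f`
eliminates `u` and leaves one elliptic equation for `v`. Its form is coercive on `H¹₀(Ω)`, so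
Lax–Milgram applies (`exists_weak_solution`). Only the sum `∇u + a∇v` is required to have divergence
in `L²`, so the jump of `a` does no harm; `hasWeakDivergence_iff` translates this condition into the
weak form.

Lumer–Phillips itself rests on the Yosida approximations `A_l = l A (l - A)⁻¹`: bounded,
dissipative, commuting, and convergent to `A` on its dense domain. Their exponentials are
contractions with `‖e^{tB} x - e^{tC} x‖ ≤ t ‖B x - C x‖`, so they converge strongly to a semigroup.
Mean value estimates uniform in `l` show that its generator extends `A`. That generator is
dissipative and `1 - A` is already onto, so the two coincide. -/

namespace KelvinVoigt

/-! ### Maximal dissipative operators, their resolvents and Yosida approximations -/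

section LumerPhillips

open NormedSpace

variable {H : Type*} [NormedAddCommGroup H] [InnerProductSpace ℂ H]

/-- The graph `Γ` of an operator `A` is maximal dissipative: `A` is single-valued,
`Re ⟨A x, x⟩ ≤ 0`, and `l - A` is onto for all `l > 0`. -/
structure IsMaximalDissipative (Γ : Submodule ℂ (H × H)) : Prop where
  re_inner_nonpos : ∀ p ∈ Γ, (inner ℂ p.2 p.1).re ≤ 0
  eq_zero_of_mem : ∀ y : H, ((0 : H), y) ∈ Γ → y = 0
  exists_resolvent : ∀ l : ℝ, 0 < l → ∀ z : H, ∃ x : H, (x, (l : ℂ) • x - z) ∈ Γ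

/-- Pair `l x - y` with `x`: the real part is at least `l ‖x‖²`, and Cauchy–Schwarz bounds it above.
-/
lemma mul_norm_le_norm_smul_sub {l : ℝ} {x y : H} (h : (inner ℂ y x).re ≤ 0) :
    l * ‖x‖ ≤ ‖(l : ℂ) • x - y‖ := by
  rcases eq_or_ne x 0 with rfl | hx
  · simp
  have h1 : (inner ℂ ((l : ℂ) • x - y) x).re = l * ‖x‖ ^ 2 - (inner ℂ y x).re := by
    rw [inner_sub_left, inner_smul_left, inner_self_eq_norm_sq_to_K]
    simp [← Complex.ofReal_pow]
  have h2 : (inner ℂ ((l : ℂ) • x - y) x).re ≤ ‖(l : ℂ) • x - y‖ * ‖x‖ :=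
    re_inner_le_norm (𝕜 := ℂ) _ _
  have hx' : 0 < ‖x‖ := norm_pos_iff.2 hx
  refine le_of_mul_le_mul_right ?_ hx'
  nlinarith

namespace IsMaximalDissipative

variable {Γ : Submodule ℂ (H × H)}

lemma mul_norm_le (hΓ : IsMaximalDissipative Γ) {l : ℝ} {x z : H}
    (h : (x, (l : ℂ) • x - z) ∈ Γ) : l * ‖x‖ ≤ ‖z‖ := by
  simpa using mul_norm_le_norm_smul_sub (l := l) (hΓ.re_inner_nonpos _ h)

/-- The difference of two solutions solves the resolvent equation with datum `0`, and the a priori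
bound kills it. -/
lemma eq_of_mem (hΓ : IsMaximalDissipative Γ) {l : ℝ} (hl : 0 < l) {x x' z : H}
    (h : (x, (l : ℂ) • x - z) ∈ Γ) (h' : (x', (l : ℂ) • x' - z) ∈ Γ) : x = x' := by
  have h1 := Γ.sub_mem h h'
  have h2 : (x - x', (l : ℂ) • (x - x') - 0) ∈ Γ := by
    convert h1 using 1
    rw [Prod.mk_sub_mk, smul_sub]
    congr 1
    abel
  have h3 := hΓ.mul_norm_le h2
  rw [norm_zero] at h3
  have h4 : ‖x - x'‖ ≤ 0 := by
    by_contra h5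
    push Not at h5
    nlinarith
  exact sub_eq_zero.1 (norm_le_zero_iff.1 h4)

/-- The resolvent `(l - A)⁻¹`. -/
lemma exists_resolvent_clm (hΓ : IsMaximalDissipative Γ) {l : ℝ} (hl : 0 < l) :
    ∃ R : H →L[ℂ] H, (∀ z, (R z, (l : ℂ) • R z - z) ∈ Γ) ∧ ∀ z, l * ‖R z‖ ≤ ‖z‖ := by
  choose R hR using hΓ.exists_resolvent l hl
  let R' : H →ₗ[ℂ] H :=
    { toFun := R
      map_add' := fun x y => hΓ.eq_of_mem hl (hR _) (by
        convert Γ.add_mem (hR x) (hR y) using 1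
        rw [Prod.mk_add_mk, smul_add]
        congr 1
        abel)
      map_smul' := fun c x => hΓ.eq_of_mem hl (hR _) (by
        convert Γ.smul_mem c (hR x) using 1
        rw [Prod.smul_mk, smul_sub, RingHom.id_apply, smul_comm c]) }
  refine ⟨R'.mkContinuous l⁻¹ fun z => ?_, hR, fun z => hΓ.mul_norm_le (hR z)⟩
  rw [← div_eq_inv_mul, le_div_iff₀ hl, mul_comm]
  exact hΓ.mul_norm_le (hR z)

/-- The resolvent `(l - A)⁻¹` of a maximal dissipative operator, for `l > 0`. -/
noncomputable def resolvent (hΓ : IsMaximalDissipative Γ) (l : ℝ) (hl : 0 < l) : H →L[ℂ] H :=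
  (hΓ.exists_resolvent_clm hl).choose

variable (hΓ : IsMaximalDissipative Γ)

lemma resolvent_mem {l : ℝ} (hl : 0 < l) (z : H) :
    (hΓ.resolvent l hl z, (l : ℂ) • hΓ.resolvent l hl z - z) ∈ Γ :=
  (hΓ.exists_resolvent_clm hl).choose_spec.1 z

lemma mul_norm_resolvent_le {l : ℝ} (hl : 0 < l) (z : H) :
    l * ‖hΓ.resolvent l hl z‖ ≤ ‖z‖ :=
  (hΓ.exists_resolvent_clm hl).choose_spec.2 z

lemma resolvent_eq {l : ℝ} (hl : 0 < l) {x z : H} (h : (x, (l : ℂ) • x - z) ∈ Γ) :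
    hΓ.resolvent l hl z = x :=
  hΓ.eq_of_mem hl (hΓ.resolvent_mem hl z) h

lemma resolvent_smul_sub {l : ℝ} (hl : 0 < l) {x y : H} (h : (x, y) ∈ Γ) :
    hΓ.resolvent l hl ((l : ℂ) • x - y) = x :=
  hΓ.resolvent_eq hl (by rwa [sub_sub_cancel])

lemma resolvent_commute {l m : ℝ} (hl : 0 < l) (hm : 0 < m) :
    Commute (hΓ.resolvent l hl) (hΓ.resolvent m hm) := by
  ext z
  change hΓ.resolvent l hl (hΓ.resolvent m hm z) = hΓ.resolvent m hm (hΓ.resolvent l hl z)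
  have hp := hΓ.resolvent_mem hl z
  set p := hΓ.resolvent l hl z
  have hq := hΓ.resolvent_mem hm p
  set q := hΓ.resolvent m hm p
  refine hΓ.resolvent_eq hl ?_
  -- This is the resolvent identity `R_m = R_l + (l - m) R_m R_l`; with it, `q` is seen to solve the
  -- equation defining `R_l (R_m z)`.
  have hw : hΓ.resolvent m hm z = p + ((l : ℂ) - m) • q := by
    refine hΓ.resolvent_eq hm ?_
    convert Γ.add_mem hp (Γ.smul_mem ((l : ℂ) - m) hq) using 1
    rw [Prod.smul_mk, Prod.mk_add_mk]
    congr 1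
    module
  rw [hw]
  convert hq using 2
  module

/-- The Yosida approximation `l² (l - A)⁻¹ - l = l A (l - A)⁻¹`. -/
noncomputable def yosida (l : ℝ) (hl : 0 < l) : H →L[ℂ] H :=
  ((l : ℂ) ^ 2) • hΓ.resolvent l hl - (l : ℂ) • 1

lemma yosida_apply {l : ℝ} (hl : 0 < l) (z : H) :
    hΓ.yosida l hl z = (l : ℂ) • ((l : ℂ) • hΓ.resolvent l hl z - z) := by
  simp only [yosida, sub_apply, smul_apply, one_apply_eq_self]
  module

/-- On the domain the resolvent commutes with `A`, so `A_l x = l R_l (A x)`; as `l R_l` is a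
contraction, `A_l x` is bounded by `A x` uniformly in `l`. -/
lemma yosida_apply_of_mem {l : ℝ} (hl : 0 < l) {x y : H} (h : (x, y) ∈ Γ) :
    hΓ.yosida l hl x = (l : ℂ) • hΓ.resolvent l hl y := by
  rw [yosida_apply]
  have h1 := hΓ.resolvent_smul_sub hl h
  rw [map_sub, map_smul] at h1
  congr 1
  rw [sub_eq_iff_eq_add, add_comm, ← sub_eq_iff_eq_add, h1]

lemma norm_smul_resolvent_le {l : ℝ} (hl : 0 < l) (y : H) :
    ‖(l : ℂ) • hΓ.resolvent l hl y‖ ≤ ‖y‖ := by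
  rw [norm_smul, Complex.norm_real, Real.norm_of_nonneg hl.le]
  exact hΓ.mul_norm_resolvent_le hl y

lemma norm_yosida_le_of_mem {l : ℝ} (hl : 0 < l) {x y : H} (h : (x, y) ∈ Γ) :
    ‖hΓ.yosida l hl x‖ ≤ ‖y‖ := by
  rw [hΓ.yosida_apply_of_mem hl h]
  exact hΓ.norm_smul_resolvent_le hl y

/-- Since `‖l R_l x‖ ≤ ‖x‖`, Cauchy–Schwarz gives `Re ⟨l R_l x - x, x⟩ ≤ 0`. -/
lemma re_inner_yosida_nonpos {l : ℝ} (hl : 0 < l) (x : H) :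
    (inner ℂ (hΓ.yosida l hl x) x).re ≤ 0 := by
  rw [yosida_apply, inner_smul_left, inner_sub_left, inner_self_eq_norm_sq_to_K]
  have h1 : (inner ℂ ((l : ℂ) • hΓ.resolvent l hl x) x).re ≤ ‖x‖ * ‖x‖ :=
    (re_inner_le_norm (𝕜 := ℂ) _ _).trans
      (mul_le_mul_of_nonneg_right (hΓ.norm_smul_resolvent_le hl x) (norm_nonneg _))
  simp only [Complex.conj_ofReal, Complex.coe_algebraMap, ← Complex.ofReal_pow,
    Complex.re_ofReal_mul, Complex.sub_re, Complex.ofReal_re]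
  nlinarith

lemma yosida_commute {l m : ℝ} (hl : 0 < l) (hm : 0 < m) :
    Commute (hΓ.yosida l hl) (hΓ.yosida m hm) := by
  have h := hΓ.resolvent_commute hl hm
  refine Commute.sub_left (Commute.sub_right ?_ ?_) (Commute.sub_right ?_ ?_)
  · exact (h.smul_left _).smul_right _
  · exact ((Commute.one_right _).smul_left _).smul_right _
  · exact ((Commute.one_left _).smul_left _).smul_right _
  · exact ((Commute.one_left _).smul_left _).smul_right _

/-- The domain of a maximal dissipative operator is dense. -/
lemma dense_domain [CompleteSpace H] (hΓ : IsMaximalDissipative Γ) :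
    Dense {x : H | ∃ y, (x, y) ∈ Γ} := by
  have h : (Γ.map (LinearMap.fst ℂ H H) : Set H) = {x : H | ∃ y, (x, y) ∈ Γ} := by
    ext x
    simp
  rw [← h, Submodule.dense_iff_topologicalClosure_eq_top, Submodule.topologicalClosure_eq_top_iff,
    Submodule.eq_bot_iff]
  intro z hz
  -- Let `z` be orthogonal to the domain and solve `x - A x = z`. Then `Re ⟨A x, x⟩ = ‖x‖²`, so
  -- dissipativity forces `x = 0`, and single-valuedness gives `z = 0`.
  obtain ⟨x, hx⟩ := hΓ.exists_resolvent 1 one_pos z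
  have h1 := hΓ.re_inner_nonpos _ hx
  have h2 : inner ℂ z x = 0 := (Submodule.mem_orthogonal' _ _).1 hz x ⟨_, hx, rfl⟩
  simp only [Complex.ofReal_one, one_smul, inner_sub_left, h2, sub_zero] at h1
  have h3 : x = 0 := by
    rw [inner_self_eq_norm_sq_to_K] at h1
    have h4 : ‖x‖ ^ 2 ≤ 0 := by simpa [← Complex.ofReal_pow] using h1
    exact norm_eq_zero.1 (by nlinarith [norm_nonneg x])
  rw [h3] at hx
  simpa using hΓ.eq_zero_of_mem _ hx

/-! ### Limits of contractions -/

lemma cauchySeq_of_dense {S : ℕ → H →L[ℂ] H} (hS : ∀ k x, ‖S k x‖ ≤ ‖x‖) {D : Set H}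
    (hD : Dense D) (h : ∀ x ∈ D, CauchySeq fun k => S k x) (x : H) : CauchySeq fun k => S k x := by
  rw [Metric.cauchySeq_iff]
  intro ε hε
  obtain ⟨x', hx', hd⟩ := hD.exists_dist_lt x (ε := ε / 3) (by positivity)
  obtain ⟨N, hN⟩ := Metric.cauchySeq_iff.1 (h x' hx') (ε / 3) (by positivity)
  refine ⟨N, fun m hm k hk => ?_⟩
  have h1 : ∀ j, dist (S j x) (S j x') < ε / 3 := fun j => by
    rw [dist_eq_norm, ← map_sub]
    exact (hS j _).trans_lt (by rwa [← dist_eq_norm])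
  calc dist (S m x) (S k x)
      ≤ dist (S m x) (S m x') + dist (S m x') (S k x') + dist (S k x') (S k x) :=
        dist_triangle4 _ _ _ _
    _ < ε / 3 + ε / 3 + ε / 3 := by
        have h2 := h1 k
        rw [dist_comm] at h2
        exact add_lt_add (add_lt_add (h1 m) (hN m hm k hk)) h2
    _ = ε := by ring

/-! ### Exponentials of bounded dissipative operators -/

variable [CompleteSpace H]

noncomputable local instance : NormedAlgebra ℚ (H →L[ℂ] H) := NormedAlgebra.restrictScalars ℚ ℂ _

lemma hasDerivAt_exp_smul_apply (B : H →L[ℂ] H) (x : H) (t : ℝ) :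
    HasDerivAt (fun s : ℝ => exp (s • B) x) (exp (t • B) (B x)) t := by
  have h := hasDerivAt_exp_smul_const (𝕂 := ℝ) B t
  exact ((ContinuousLinearMap.apply ℂ H x).restrictScalars ℝ).hasFDerivAt.comp_hasDerivAt t h

/-- With `B` outside, the derivative suits the energy identity; the form with `B` inside suits mean
value estimates, where the contraction acts on a fixed vector. -/
lemma hasDerivAt_exp_smul_apply' (B : H →L[ℂ] H) (x : H) (t : ℝ) :
    HasDerivAt (fun s : ℝ => exp (s • B) x) (B (exp (t • B) x)) t := by
  have h := hasDerivAt_exp_smul_const' (𝕂 := ℝ) B t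
  exact ((ContinuousLinearMap.apply ℂ H x).restrictScalars ℝ).hasFDerivAt.comp_hasDerivAt t h

/-- The energy `‖e^{sB} x‖²` has derivative `2 Re ⟨B e^{sB} x, e^{sB} x⟩ ≤ 0`. -/
lemma norm_exp_smul_apply_le {B : H →L[ℂ] H} (hB : ∀ x, (inner ℂ (B x) x).re ≤ 0) {t : ℝ}
    (ht : 0 ≤ t) (x : H) : ‖exp (t • B) x‖ ≤ ‖x‖ := by
  have hd : ∀ s : ℝ, HasDerivAt (fun s : ℝ => ‖exp (s • B) x‖ ^ 2)
      (2 * (inner ℂ (B (exp (s • B) x)) (exp (s • B) x)).re) s := by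
    intro s
    have h1 := hasDerivAt_exp_smul_apply' B x s
    have h2 := Complex.reCLM.hasFDerivAt.comp_hasDerivAt s (h1.inner ℂ h1)
    have h3 : (fun s : ℝ => ‖exp (s • B) x‖ ^ 2) =
        Complex.reCLM ∘ fun s : ℝ => inner ℂ (exp (s • B) x) (exp (s • B) x) := by
      funext r
      exact norm_sq_eq_re_inner (𝕜 := ℂ) _
    have h4 : (inner ℂ (exp (s • B) x) (B (exp (s • B) x))).re =
        (inner ℂ (B (exp (s • B) x)) (exp (s • B) x)).re := inner_re_symm (𝕜 := ℂ) _ _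
    rw [h3]
    refine h2.congr_deriv ?_
    rw [Complex.reCLM_apply, Complex.add_re, h4, two_mul]
  have hanti : Antitone fun s : ℝ => ‖exp (s • B) x‖ ^ 2 :=
    antitone_of_hasDerivAt_nonpos hd fun s => by
      exact mul_nonpos_of_nonneg_of_nonpos zero_le_two (hB (exp (s • B) x))
  have h := hanti ht
  simp only [zero_smul, exp_zero, one_apply_eq_self] at h
  exact (sq_le_sq₀ (norm_nonneg _) (norm_nonneg _)).1 h

/-- `‖e^{tB} x - e^{tC} x‖ ≤ t ‖B x - C x‖` for commuting dissipative `B`, `C`. -/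
lemma norm_exp_smul_sub_exp_smul_le {B C : H →L[ℂ] H} (hB : ∀ x, (inner ℂ (B x) x).re ≤ 0)
    (hC : ∀ x, (inner ℂ (C x) x).re ≤ 0) (hBC : Commute B C) {t : ℝ} (ht : 0 ≤ t) (x : H) :
    ‖exp (t • B) x - exp (t • C) x‖ ≤ t * ‖B x - C x‖ := by
  have hcomm : Commute (t • C) (B - C) := by
    refine Commute.smul_left ?_ t
    exact hBC.symm.sub_right (Commute.refl C)
  -- The path `s ↦ e^{sB} e^{(t-s)C} x` joins `e^{tC} x` to `e^{tB} x`. By commutation its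
  -- derivative is a product of two contractions applied to `(B - C) x`.
  have key : ∀ s : ℝ, exp (t • C) * exp (s • (B - C)) = exp (s • B) * exp ((t - s) • C) := by
    intro s
    rw [← exp_add_of_commute (hcomm.smul_right s),
      ← exp_add_of_commute ((hBC.smul_left s).smul_right (t - s))]
    congr 1
    module
  have hd : ∀ s : ℝ, HasDerivAt (fun s : ℝ => exp (t • C) (exp (s • (B - C)) x))
      (exp (t • C) (exp (s • (B - C)) ((B - C) x))) s := fun s =>
    ((exp (t • C)).restrictScalars ℝ).hasFDerivAt.comp_hasDerivAt s
      (hasDerivAt_exp_smul_apply (B - C) x s)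
  have h := norm_image_sub_le_of_norm_deriv_le_segment' (C := ‖B x - C x‖)
    (fun s _ => (hd s).hasDerivWithinAt) (fun s hs => by
      have h1 := congrArg (fun T : H →L[ℂ] H => T ((B - C) x)) (key s)
      simp only [mul_apply_eq_comp] at h1
      rw [h1]
      refine (norm_exp_smul_apply_le hB hs.1 _).trans ?_
      exact norm_exp_smul_apply_le hC (sub_nonneg.2 hs.2.le) _) t ⟨ht, le_rfl⟩
  have h1 := congrArg (fun T : H →L[ℂ] H => T x) (key t)
  simp only [mul_apply_eq_comp, sub_self, zero_smul, exp_zero,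
    one_apply_eq_self] at h1
  rw [h1] at h
  simpa [mul_comm] using h

/-- `‖e^{tB} x - x - t y‖ ≤ t C` if `‖e^{sB} B x - y‖ ≤ C` for `s ≤ t`. -/
lemma norm_exp_smul_apply_sub_sub_le (B : H →L[ℂ] H) (x y : H) {t C : ℝ} (ht : 0 ≤ t)
    (hC : ∀ s, 0 ≤ s → s ≤ t → ‖exp (s • B) (B x) - y‖ ≤ C) :
    ‖exp (t • B) x - x - t • y‖ ≤ t * C := by
  have hd : ∀ s : ℝ, HasDerivAt (fun s : ℝ => exp (s • B) x - s • y)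
      (exp (s • B) (B x) - y) s := fun s => by
    refine ((hasDerivAt_exp_smul_apply B x s).sub ((hasDerivAt_id s).smul_const y)).congr_deriv ?_
    rw [one_smul]
  have h := norm_image_sub_le_of_norm_deriv_le_segment' (C := C)
    (fun s _ => (hd s).hasDerivWithinAt) (fun s hs => hC s hs.1 hs.2.le) t ⟨ht, le_rfl⟩
  simp only [zero_smul, exp_zero, one_apply_eq_self, sub_zero] at h
  rw [mul_comm]
  convert h using 2
  abel

lemma norm_exp_smul_apply_sub_le {B : H →L[ℂ] H} (hB : ∀ x, (inner ℂ (B x) x).re ≤ 0) {t : ℝ}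
    (ht : 0 ≤ t) (x : H) : ‖exp (t • B) x - x‖ ≤ t * ‖B x‖ := by
  simpa using norm_exp_smul_apply_sub_sub_le B x 0 ht (C := ‖B x‖) fun s hs _ => by
    simpa using norm_exp_smul_apply_le hB hs (B x)

/-- A limit `z` exists by the Cauchy criterion; contractivity gives `‖z - x'‖ ≤ ‖x - x'‖` for `x'`
in the dense set, so `z` is arbitrarily close to `x`. -/
lemma tendsto_self_of_dense {S : ℕ → H →L[ℂ] H} (hS : ∀ k x, ‖S k x‖ ≤ ‖x‖) {D : Set H}
    (hD : Dense D) (h : ∀ x ∈ D, Tendsto (fun k => S k x) atTop (𝓝 x)) (x : H) :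
    Tendsto (fun k => S k x) atTop (𝓝 x) := by
  obtain ⟨z, hz⟩ := cauchySeq_tendsto_of_complete
    (cauchySeq_of_dense hS hD (fun x hx => (h x hx).cauchySeq) x)
  have h1 : ‖z - x‖ ≤ 0 := by
    refine le_of_forall_pos_le_add fun ε hε => ?_
    obtain ⟨x', hx', hd⟩ := hD.exists_dist_lt x (ε := ε / 2) (by positivity)
    rw [dist_eq_norm] at hd
    have h2 : ‖z - x'‖ ≤ ‖x - x'‖ :=
      le_of_tendsto (hz.sub (h x' hx')).norm (Eventually.of_forall fun k => by
        rw [← map_sub]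
        exact hS k _)
    have h3 : ‖z - x‖ ≤ ‖z - x'‖ + ‖x - x'‖ := by
      rw [norm_sub_rev x x']
      exact norm_sub_le_norm_sub_add_norm_sub _ _ _
    linarith
  rwa [sub_eq_zero.1 (norm_le_zero_iff.1 h1)] at hz

/-! ### The Hille–Yosida construction -/

/-- The Yosida approximation with parameter `k + 1`. -/
noncomputable def yosidaSeq (hΓ : IsMaximalDissipative Γ) (k : ℕ) : H →L[ℂ] H :=
  hΓ.yosida (k + 1) k.cast_add_one_pos

lemma norm_exp_yosidaSeq_le (hΓ : IsMaximalDissipative Γ) (k : ℕ) {t : ℝ} (ht : 0 ≤ t) (x : H) :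
    ‖exp (t • hΓ.yosidaSeq k) x‖ ≤ ‖x‖ :=
  norm_exp_smul_apply_le (hΓ.re_inner_yosida_nonpos _) ht x

lemma tendsto_smul_resolvent (hΓ : IsMaximalDissipative Γ) (y : H) :
    Tendsto (fun k : ℕ => (((k + 1 : ℝ) : ℂ) • hΓ.resolvent (k + 1) k.cast_add_one_pos) y)
      atTop (𝓝 y) := by
  refine tendsto_self_of_dense (fun k x => hΓ.norm_smul_resolvent_le k.cast_add_one_pos x)
    hΓ.dense_domain ?_ y
  rintro x ⟨w, hw⟩
  rw [tendsto_iff_norm_sub_tendsto_zero]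
  refine squeeze_zero (fun _ => norm_nonneg _) (g := fun k : ℕ => ‖w‖ * (1 / ((k : ℝ) + 1)))
    (fun k => ?_) (by simpa using tendsto_one_div_add_atTop_nhds_zero_nat.const_mul ‖w‖)
  have hk : (0 : ℝ) < k + 1 := k.cast_add_one_pos
  -- On the domain, `l R_l x - x = R_l (A x)`, which has norm at most `‖A x‖ / l`.
  have h1 := hΓ.resolvent_smul_sub hk hw
  rw [map_sub, map_smul, sub_eq_iff_eq_add, ← sub_eq_iff_eq_add'] at h1
  rw [smul_apply, h1, mul_one_div, le_div_iff₀ hk, mul_comm]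
  exact hΓ.mul_norm_resolvent_le hk w

lemma tendsto_yosidaSeq (hΓ : IsMaximalDissipative Γ) {x y : H} (h : (x, y) ∈ Γ) :
    Tendsto (fun k => hΓ.yosidaSeq k x) atTop (𝓝 y) := by
  refine (hΓ.tendsto_smul_resolvent y).congr fun k => ?_
  exact (hΓ.yosida_apply_of_mem _ h).symm

lemma cauchySeq_exp_yosidaSeq (hΓ : IsMaximalDissipative Γ) {t : ℝ} (ht : 0 ≤ t) (x : H) :
    CauchySeq fun k => exp (t • hΓ.yosidaSeq k) x := by
  refine cauchySeq_of_dense (fun k x => hΓ.norm_exp_yosidaSeq_le k ht x) hΓ.dense_domain ?_ x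
  rintro x ⟨y, hy⟩
  rw [Metric.cauchySeq_iff]
  intro ε hε
  -- Dividing by `t + 1` rather than `t` covers `t = 0`.
  obtain ⟨N, hN⟩ := Metric.cauchySeq_iff.1 (hΓ.tendsto_yosidaSeq hy).cauchySeq (ε / (t + 1))
    (by positivity)
  refine ⟨N, fun m hm k hk => ?_⟩
  have h1 := hN m hm k hk
  rw [lt_div_iff₀ (by positivity), dist_eq_norm] at h1
  rw [dist_eq_norm]
  refine (norm_exp_smul_sub_exp_smul_le (hΓ.re_inner_yosida_nonpos _)
    (hΓ.re_inner_yosida_nonpos _) (hΓ.yosida_commute _ _) ht x).trans_lt ?_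
  refine lt_of_le_of_lt ?_ h1
  rw [mul_comm]
  exact mul_le_mul_of_nonneg_left (by linarith) (norm_nonneg _)

lemma exists_tendsto_exp_yosidaSeq (hΓ : IsMaximalDissipative Γ) (t : ℝ≥0) :
    ∃ T : H →L[ℂ] H, ∀ x, Tendsto (fun k => exp ((t : ℝ) • hΓ.yosidaSeq k) x) atTop (𝓝 (T x)) := by
  choose f hf using fun x => cauchySeq_tendsto_of_complete (hΓ.cauchySeq_exp_yosidaSeq t.2 x)
  exact ⟨continuousLinearMapOfTendsto _ (tendsto_pi_nhds.2 hf), hf⟩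

/-- The semigroup generated by a maximal dissipative operator. -/
noncomputable def semigroup (hΓ : IsMaximalDissipative Γ) (t : ℝ≥0) : H →L[ℂ] H :=
  (hΓ.exists_tendsto_exp_yosidaSeq t).choose

lemma tendsto_semigroup (hΓ : IsMaximalDissipative Γ) (t : ℝ≥0) (x : H) :
    Tendsto (fun k => exp ((t : ℝ) • hΓ.yosidaSeq k) x) atTop (𝓝 (hΓ.semigroup t x)) :=
  (hΓ.exists_tendsto_exp_yosidaSeq t).choose_spec x

lemma norm_semigroup_apply_le (hΓ : IsMaximalDissipative Γ) (t : ℝ≥0) (x : H) :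
    ‖hΓ.semigroup t x‖ ≤ ‖x‖ :=
  le_of_tendsto (hΓ.tendsto_semigroup t x).norm
    (Eventually.of_forall fun k => hΓ.norm_exp_yosidaSeq_le k t.2 x)

lemma semigroup_zero (hΓ : IsMaximalDissipative Γ) :
    hΓ.semigroup 0 = ContinuousLinearMap.id ℂ H := by
  ext x
  refine tendsto_nhds_unique (hΓ.tendsto_semigroup 0 x) ?_
  simp

lemma semigroup_add (hΓ : IsMaximalDissipative Γ) (s t : ℝ≥0) :
    hΓ.semigroup (s + t) = (hΓ.semigroup s).comp (hΓ.semigroup t) := by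
  ext x
  refine tendsto_nhds_unique (hΓ.tendsto_semigroup (s + t) x) ?_
  -- Both factors vary with `k`; uniform contractivity lets the inner one be replaced by its limit.
  have h1 : Tendsto (fun k => exp ((s : ℝ) • hΓ.yosidaSeq k)
      (exp ((t : ℝ) • hΓ.yosidaSeq k) x - hΓ.semigroup t x)) atTop (𝓝 0) := by
    refine squeeze_zero_norm (fun k => hΓ.norm_exp_yosidaSeq_le k s.2 _) ?_
    exact tendsto_iff_norm_sub_tendsto_zero.1 (hΓ.tendsto_semigroup t x)
  have h2 := h1.add (hΓ.tendsto_semigroup s (hΓ.semigroup t x))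
  rw [zero_add] at h2
  refine h2.congr fun k => ?_
  rw [map_sub, sub_add_cancel, NNReal.coe_add, add_smul, exp_add_of_commute
    (((Commute.refl (hΓ.yosidaSeq k)).smul_left _).smul_right _), mul_apply_eq_comp]

/-- Approximating `y` by `y'` in the domain costs `2 ‖y - y'‖`, while `y'` moves at speed at most
`‖w‖`. The bound does not depend on `k`, so it passes to the semigroup. -/
lemma norm_exp_yosidaSeq_sub_le (hΓ : IsMaximalDissipative Γ) (k : ℕ) {t : ℝ} (ht : 0 ≤ t)
    {y' w : H} (h : (y', w) ∈ Γ) (y : H) :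
    ‖exp (t • hΓ.yosidaSeq k) y - y‖ ≤ 2 * ‖y - y'‖ + t * ‖w‖ := by
  have h1 : ‖exp (t • hΓ.yosidaSeq k) y' - y'‖ ≤ t * ‖w‖ :=
    (norm_exp_smul_apply_sub_le (hΓ.re_inner_yosida_nonpos _) ht y').trans
      (mul_le_mul_of_nonneg_left (hΓ.norm_yosida_le_of_mem _ h) ht)
  have h2 : exp (t • hΓ.yosidaSeq k) y - y = exp (t • hΓ.yosidaSeq k) (y - y') - (y - y') +
      (exp (t • hΓ.yosidaSeq k) y' - y') := by
    rw [map_sub]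
    abel
  rw [h2]
  refine (norm_add_le _ _).trans (add_le_add ((norm_sub_le _ _).trans ?_) h1)
  rw [two_mul]
  exact add_le_add_left (hΓ.norm_exp_yosidaSeq_le k ht _) _

lemma norm_semigroup_sub_le (hΓ : IsMaximalDissipative Γ) (t : ℝ≥0) {y' w : H}
    (h : (y', w) ∈ Γ) (y : H) : ‖hΓ.semigroup t y - y‖ ≤ 2 * ‖y - y'‖ + t * ‖w‖ :=
  le_of_tendsto ((hΓ.tendsto_semigroup t y).sub_const y).norm
    (Eventually.of_forall fun k => hΓ.norm_exp_yosidaSeq_sub_le k t.2 h y)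

/-! ### Identification of the generator -/

lemma norm_semigroup_sub_sub_le (hΓ : IsMaximalDissipative Γ) (t : ℝ≥0) {x y y' w : H}
    (hxy : (x, y) ∈ Γ) (h : (y', w) ∈ Γ) :
    ‖hΓ.semigroup t x - x - (t : ℝ) • y‖ ≤ t * (2 * ‖y - y'‖ + t * ‖w‖) := by
  have h1 : Tendsto (fun k => t * (‖hΓ.yosidaSeq k x - y‖ + (2 * ‖y - y'‖ + t * ‖w‖))) atTop
      (𝓝 (t * (0 + (2 * ‖y - y'‖ + t * ‖w‖)))) :=
    ((tendsto_iff_norm_sub_tendsto_zero.1 (hΓ.tendsto_yosidaSeq hxy)).add_const _).const_mul _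
  rw [zero_add] at h1
  refine le_of_tendsto_of_tendsto (((hΓ.tendsto_semigroup t x).sub_const x).sub_const _).norm h1
    (Eventually.of_forall fun k => ?_)
  -- The derivative of `e^{sA_k} x` is `e^{sA_k} A_k x`; its distance to `y` splits into the Yosida
  -- error and the motion of `y` under `e^{sA_k}`.
  refine norm_exp_smul_apply_sub_sub_le _ x y t.2 fun s hs hst => ?_
  have h2 : exp (s • hΓ.yosidaSeq k) (hΓ.yosidaSeq k x) - y =
      exp (s • hΓ.yosidaSeq k) (hΓ.yosidaSeq k x - y) + (exp (s • hΓ.yosidaSeq k) y - y) := by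
    rw [map_sub]
    abel
  rw [h2]
  refine (norm_add_le _ _).trans (add_le_add (hΓ.norm_exp_yosidaSeq_le k hs _) ?_)
  refine (hΓ.norm_exp_yosidaSeq_sub_le k hs h y).trans ?_
  gcongr

lemma tendsto_semigroup_zero (hΓ : IsMaximalDissipative Γ) (y : H) :
    Tendsto (fun t => hΓ.semigroup t y) (𝓝[>] 0) (𝓝 y) := by
  rw [Metric.tendsto_nhds]
  intro ε hε
  obtain ⟨y', ⟨w, hw⟩, hd⟩ := hΓ.dense_domain.exists_dist_lt y (ε := ε / 2) (by positivity)
  have hlim : Tendsto (fun t : ℝ≥0 => 2 * ‖y - y'‖ + t * ‖w‖) (𝓝[>] 0)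
      (𝓝 (2 * ‖y - y'‖ + ((0 : ℝ≥0) : ℝ) * ‖w‖)) :=
    (Continuous.tendsto (by fun_prop) 0).mono_left nhdsWithin_le_nhds
  rw [dist_eq_norm] at hd
  filter_upwards [hlim.eventually_lt_const (u := ε) (by simp; linarith)] with t ht
  rw [dist_eq_norm]
  exact (hΓ.norm_semigroup_sub_le t hw y).trans_lt ht

lemma tendsto_quotient_of_mem (hΓ : IsMaximalDissipative Γ) {x y : H} (h : (x, y) ∈ Γ) :
    Tendsto (fun t : ℝ≥0 => ((t : ℝ) : ℂ)⁻¹ • (hΓ.semigroup t x - x)) (𝓝[>] 0) (𝓝 y) := by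
  rw [Metric.tendsto_nhds]
  intro ε hε
  obtain ⟨y', ⟨w, hw⟩, hd⟩ := hΓ.dense_domain.exists_dist_lt y (ε := ε / 2) (by positivity)
  have hlim : Tendsto (fun t : ℝ≥0 => 2 * ‖y - y'‖ + t * ‖w‖) (𝓝[>] 0)
      (𝓝 (2 * ‖y - y'‖ + ((0 : ℝ≥0) : ℝ) * ‖w‖)) :=
    (Continuous.tendsto (by fun_prop) 0).mono_left nhdsWithin_le_nhds
  rw [dist_eq_norm] at hd
  filter_upwards [hlim.eventually_lt_const (u := ε) (by simp; linarith), self_mem_nhdsWithin]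
    with t ht ht0
  have ht1 : (0 : ℝ) < t := ht0
  have ht2 : ((t : ℝ) : ℂ) ≠ 0 := by exact_mod_cast ht1.ne'
  have h1 : ((t : ℝ) : ℂ)⁻¹ • (hΓ.semigroup t x - x) - y =
      ((t : ℝ) : ℂ)⁻¹ • (hΓ.semigroup t x - x - (t : ℝ) • y) := by
    rw [smul_sub _ _ ((t : ℝ) • y), ← Complex.coe_smul (t : ℝ) y, smul_smul, inv_mul_cancel₀ ht2,
      one_smul]
  rw [dist_eq_norm, h1, norm_smul, norm_inv, Complex.norm_real, Real.norm_of_nonneg ht1.le,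
    inv_mul_lt_iff₀ ht1]
  exact (hΓ.norm_semigroup_sub_sub_le t h hw).trans_lt (mul_lt_mul_of_pos_left ht ht1)

/-- Contractivity gives `Re ⟨T t x - x, x⟩ ≤ 0` before the limit, so the generator of the semigroup
is dissipative. -/
lemma re_inner_nonpos_of_tendsto_quotient (hΓ : IsMaximalDissipative Γ) {x y : H}
    (h : Tendsto (fun t : ℝ≥0 => ((t : ℝ) : ℂ)⁻¹ • (hΓ.semigroup t x - x)) (𝓝[>] 0) (𝓝 y)) :
    (inner ℂ y x).re ≤ 0 := by
  have h1 := (Complex.continuous_re.tendsto _).comp (h.inner (𝕜 := ℂ) (tendsto_const_nhds (x := x)))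
  refine le_of_tendsto h1 (Eventually.of_forall fun t => ?_)
  have h2 : (inner ℂ (hΓ.semigroup t x) x).re ≤ ‖x‖ * ‖x‖ :=
    (re_inner_le_norm (𝕜 := ℂ) _ _).trans
      (mul_le_mul_of_nonneg_right (hΓ.norm_semigroup_apply_le t x) (norm_nonneg _))
  have h3 : (inner ℂ (hΓ.semigroup t x - x) x).re ≤ 0 := by
    have h4 : (inner ℂ x x).re = ‖x‖ * ‖x‖ := inner_self_eq_norm_mul_norm (𝕜 := ℂ) x
    rw [inner_sub_left, Complex.sub_re, h4]
    linarith
  simp only [Function.comp_apply]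
  rw [inner_smul_left, ← Complex.ofReal_inv, Complex.conj_ofReal, Complex.re_ofReal_mul]
  exact mul_nonpos_of_nonneg_of_nonpos (by positivity) h3

lemma mem_of_tendsto_quotient (hΓ : IsMaximalDissipative Γ) {x y : H}
    (h : Tendsto (fun t : ℝ≥0 => ((t : ℝ) : ℂ)⁻¹ • (hΓ.semigroup t x - x)) (𝓝[>] 0) (𝓝 y)) :
    (x, y) ∈ Γ := by
  -- Solve `x' - A x' = x - y` in the domain of `A`. The generator then maps `x - x'` to itself, so
  -- dissipativity forces `x = x'`.
  obtain ⟨x', hx'⟩ := hΓ.exists_resolvent 1 one_pos (x - y)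
  rw [Complex.ofReal_one, one_smul] at hx'
  have h1 := h.sub (hΓ.tendsto_quotient_of_mem hx')
  have h2 : y - (x' - (x - y)) = x - x' := by abel
  have h3 : (inner ℂ (x - x') (x - x')).re ≤ 0 := by
    refine hΓ.re_inner_nonpos_of_tendsto_quotient ?_
    rw [h2] at h1
    refine h1.congr fun t => ?_
    rw [← smul_sub, map_sub]
    congr 1
    abel
  have h4 : x - x' = 0 := by
    have h5 : ‖x - x'‖ ^ 2 ≤ 0 := (norm_sq_eq_re_inner (𝕜 := ℂ) (x - x')).trans_le h3
    exact norm_eq_zero.1 (by nlinarith [norm_nonneg (x - x')])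
  rw [← sub_eq_zero.1 h4, sub_sub_cancel] at hx'
  exact hx'

/-- The Lumer–Phillips theorem: a maximal dissipative operator in a Hilbert space generates a
`C₀`-semigroup of contractions. -/
theorem generatesContractionC0Semigroup {A : H →ₗ.[ℂ] H} (hA : IsMaximalDissipative A.graph) :
    GeneratesContractionC0Semigroup A :=
  ⟨hA.semigroup,
    { map_zero := hA.semigroup_zero
      map_add := hA.semigroup_add
      tendsto_zero := hA.tendsto_semigroup_zero
      norm_le_one := fun t => ContinuousLinearMap.opNorm_le_bound _ zero_le_one fun x => by
        rw [one_mul]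
        exact hA.norm_semigroup_apply_le t x },
    fun _ _ => ⟨hA.tendsto_quotient_of_mem, hA.mem_of_tendsto_quotient⟩⟩

end IsMaximalDissipative

end LumerPhillips

/-! ### Lax–Milgram and the weak form of the divergence -/

/-- The Lax–Milgram theorem. -/
lemma surjective_of_coercive {V : Type*} [NormedAddCommGroup V] [InnerProductSpace ℂ V]
    [CompleteSpace V] (B : V →L[ℂ] V) {c : ℝ} (hc : 0 < c)
    (hB : ∀ v, c * ‖v‖ ^ 2 ≤ (inner ℂ v (B v)).re) : Function.Surjective B := by
  have hle : ∀ v, c * ‖v‖ ≤ ‖B v‖ := fun v => by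
    rcases eq_or_ne v 0 with rfl | hv
    · simp
    have h1 : (inner ℂ v (B v)).re ≤ ‖v‖ * ‖B v‖ := re_inner_le_norm (𝕜 := ℂ) _ _
    have hv' : 0 < ‖v‖ := norm_pos_iff.2 hv
    refine le_of_mul_le_mul_left ?_ hv'
    nlinarith [hB v]
  have hanti : AntilipschitzWith (Real.toNNReal c⁻¹) B :=
    ContinuousLinearMap.antilipschitz_of_bound B fun v => by
      rw [Real.coe_toNNReal _ (inv_nonneg.2 hc.le), ← div_eq_inv_mul, le_div_iff₀ hc, mul_comm]
      exact hle v
  have hcl : IsClosed (B.range : Set V) := hanti.isClosed_range B.uniformContinuous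
  have := hcl.completeSpace_coe
  -- The range is closed by the lower bound. A vector orthogonal to it is orthogonal to its own
  -- image, so coercivity makes it zero.
  have hort : B.rangeᗮ = ⊥ := by
    rw [Submodule.eq_bot_iff]
    intro v hv
    have h1 : inner ℂ v (B v) = 0 := (Submodule.mem_orthogonal' _ _).1 hv _ ⟨v, rfl⟩
    have h2 := hB v
    rw [h1, Complex.zero_re] at h2
    have h3 : ‖v‖ ^ 2 ≤ 0 := nonpos_of_mul_nonpos_right h2 hc
    exact norm_eq_zero.1 (by nlinarith [norm_nonneg v])
  exact LinearMap.range_eq_top.1 ((Submodule.orthogonal_eq_bot_iff).1 hort)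

variable {n : ℕ} {Ω : Opens (EuclideanSpace ℝ (Fin n))}

/-- The complex conjugate of a test function. -/
noncomputable def conjTest (φ : 𝓓(Ω, ℂ)) : 𝓓(Ω, ℂ) :=
  ⟨fun x => (starRingEnd ℂ) (φ x), Complex.conjCLE.contDiff.comp φ.contDiff,
    φ.hasCompactSupport.comp_left (map_zero _),
    (closure_mono fun x hx => by simpa using hx).trans φ.tsupport_subset⟩

lemma conjTest_apply (φ : 𝓓(Ω, ℂ)) (x : EuclideanSpace ℝ (Fin n)) :
    conjTest φ x = (starRingEnd ℂ) (φ x) :=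
  rfl

lemma grad_conjTest_apply (φ : 𝓓(Ω, ℂ)) (x : EuclideanSpace ℝ (Fin n)) (i : Fin n) :
    grad (conjTest φ) x i = (starRingEnd ℂ) (grad φ x i) := by
  have h : HasFDerivAt (conjTest φ) ((Complex.conjCLE : ℂ →L[ℝ] ℂ).comp (fderiv ℝ φ x)) x :=
    (Complex.conjCLE : ℂ →L[ℝ] ℂ).hasFDerivAt.comp x (testFunction_differentiable φ x).hasFDerivAt
  simp only [grad]
  rw [h.fderiv]
  rfl

/-- The distributional pairing is bilinear while `inner` conjugates its first argument; `conjTest`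
reconciles the two. -/
lemma inner_eq_integral_of_ae_eq {g F : L2Vec Ω} {φ : 𝓓(Ω, ℂ)}
    (hg : g =ᵐ[volume.restrict (Ω : Set (EuclideanSpace ℝ (Fin n)))] grad (conjTest φ)) :
    inner ℂ g F = ∫ x in (Ω : Set (EuclideanSpace ℝ (Fin n))), ∑ i, F x i * grad φ x i := by
  rw [L2.inner_def]
  refine integral_congr_ae ?_
  filter_upwards [hg] with x hx
  rw [hx, PiLp.inner_apply]
  refine Finset.sum_congr rfl fun i _ => ?_
  rw [grad_conjTest_apply]
  simp

lemma inner_eq_integral_mul_of_ae_eq {u h : L2 Ω} {φ : 𝓓(Ω, ℂ)}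
    (hu : u =ᵐ[volume.restrict (Ω : Set (EuclideanSpace ℝ (Fin n)))] conjTest φ) :
    inner ℂ u h = ∫ x in (Ω : Set (EuclideanSpace ℝ (Fin n))), h x * φ x := by
  rw [L2.inner_def]
  refine integral_congr_ae ?_
  filter_upwards [hu] with x hx
  rw [hx, conjTest_apply]
  simp

/-- Every test function is in `H¹₀(Ω)`. -/
lemma H10.exists_of_test (φ : 𝓓(Ω, ℂ)) :
    ∃ w : H10 Ω,
      H10.toL2 Ω w =ᵐ[volume.restrict (Ω : Set (EuclideanSpace ℝ (Fin n)))] φ ∧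
      H10.gradient Ω w =ᵐ[volume.restrict (Ω : Set (EuclideanSpace ℝ (Fin n)))] grad φ := by
  have h1 : MemLp φ 2 (volume.restrict (Ω : Set (EuclideanSpace ℝ (Fin n)))) :=
    (φ.continuous.memLp_of_hasCompactSupport φ.hasCompactSupport).restrict _
  have hs : HasCompactSupport (grad φ) := by
    have : grad (⇑φ) = (fun L : EuclideanSpace ℝ (Fin n) →L[ℝ] ℂ =>
        (WithLp.toLp 2 fun i => L (EuclideanSpace.single i 1) : EuclideanSpace ℂ (Fin n))) ∘
        fderiv ℝ φ := rfl
    rw [this]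
    refine (φ.hasCompactSupport.fderiv ℝ).comp_left ?_
    ext i
    simp
  have hc : Continuous (grad φ) :=
    (PiLp.continuous_toLp 2 _).comp (continuous_pi fun i => continuous_grad_apply φ i)
  have h2 : MemLp (grad φ) 2 (volume.restrict (Ω : Set (EuclideanSpace ℝ (Fin n)))) :=
    (hc.memLp_of_hasCompactSupport hs).restrict _
  exact ⟨⟨(h1.toLp, h2.toLp), subset_closure ⟨φ, h1.coeFn_toLp, h2.coeFn_toLp⟩⟩,
    h1.coeFn_toLp, h2.coeFn_toLp⟩

/-- `div F = h` in the sense of distributions iff `⟨∇w, F⟩ = -⟨w, h⟩` for all `w ∈ H¹₀(Ω)`. -/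
lemma hasWeakDivergence_iff (F : L2Vec Ω) (h : L2 Ω) :
    HasWeakDivergence Ω F h ↔
      ∀ w : H10 Ω, inner ℂ (H10.gradient Ω w) F = -inner ℂ (H10.toL2 Ω w) h := by
  constructor
  · intro hd w
    -- Both sides are continuous in the pair `(w, ∇w)`, so the identity extends from test functions
    -- to the closure.
    have hcl : IsClosed {p : L2 Ω × L2Vec Ω | inner ℂ p.2 F = -inner ℂ p.1 h} :=
      isClosed_eq (by fun_prop) (by fun_prop)
    refine closure_minimal ?_ hcl (H10.mem_closure w)
    rintro p ⟨φ, h1, h2⟩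
    have h3 : φ = conjTest (conjTest φ) := by
      ext x
      simp [conjTest_apply]
    rw [h3] at h1 h2
    change inner ℂ p.2 F = -inner ℂ p.1 h
    rw [inner_eq_integral_of_ae_eq h2, inner_eq_integral_mul_of_ae_eq h1]
    exact hd _
  · intro hd φ
    obtain ⟨w, h1, h2⟩ := H10.exists_of_test (conjTest φ)
    rw [← inner_eq_integral_of_ae_eq h2, ← inner_eq_integral_mul_of_ae_eq h1]
    exact hd w

variable (Ω) in
/-- Multiplication of vector fields by the damping coefficient. -/
noncomputable def dampingMul (ω : Opens (EuclideanSpace ℝ (Fin n))) (d : ℝ) : L2Vec Ω →L[ℂ] L2Vec Ω :=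
  LinearMap.mkContinuous
    { toFun := fun g => (memLp_damping_smul ω d g).toLp
      map_add' := fun g g' => by
        rw [← MemLp.toLp_add]
        refine MemLp.toLp_congr _ _ ?_
        filter_upwards [Lp.coeFn_add g g'] with x hx
        rw [hx, Pi.add_apply, Pi.add_apply, smul_add]
      map_smul' := fun c g => by
        rw [RingHom.id_apply, ← MemLp.toLp_const_smul]
        refine MemLp.toLp_congr _ _ ?_
        filter_upwards [Lp.coeFn_smul c g] with x hx
        rw [hx, Pi.smul_apply, Pi.smul_apply, smul_comm] } |d| fun g => by
    refine Lp.norm_le_mul_norm_of_ae_le_mul ?_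
    filter_upwards [(memLp_damping_smul ω d g).coeFn_toLp] with x hx
    refine (congrArg norm hx).trans_le ?_
    rw [norm_smul, Complex.norm_real]
    refine mul_le_mul_of_nonneg_right ?_ (norm_nonneg _)
    by_cases h : x ∈ (ω : Set (EuclideanSpace ℝ (Fin n))) <;> simp [damping, h]

lemma coeFn_dampingMul (ω : Opens (EuclideanSpace ℝ (Fin n))) (d : ℝ) (g : L2Vec Ω) :
    dampingMul Ω ω d g =ᵐ[volume.restrict (Ω : Set (EuclideanSpace ℝ (Fin n)))]
      fun x => (damping ω d x : ℂ) • g x :=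
  (memLp_damping_smul ω d g).coeFn_toLp

lemma re_inner_dampingMul_nonneg (ω : Opens (EuclideanSpace ℝ (Fin n))) {d : ℝ} (hd : 0 ≤ d)
    (g : L2Vec Ω) : 0 ≤ (inner ℂ g (dampingMul Ω ω d g)).re := by
  have h1 : inner ℂ g (dampingMul Ω ω d g) =
      ∫ x in (Ω : Set (EuclideanSpace ℝ (Fin n))), ((damping ω d x * ‖g x‖ ^ 2 : ℝ) : ℂ) := by
    rw [L2.inner_def]
    refine integral_congr_ae ?_
    filter_upwards [coeFn_dampingMul ω d g] with x hx
    rw [hx, inner_smul_right, inner_self_eq_norm_sq_to_K]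
    simp
  rw [h1, integral_complex_ofReal, Complex.ofReal_re]
  refine integral_nonneg fun x => mul_nonneg ?_ (by positivity)
  exact Set.indicator_nonneg (fun _ _ => hd) x

lemma isLaplacianAddDiv_iff (ω : Opens (EuclideanSpace ℝ (Fin n))) (d : ℝ) (u v : H10 Ω)
    (h : L2 Ω) :
    IsLaplacianAddDiv (damping ω d) u v h ↔
      ∀ w : H10 Ω, inner ℂ (H10.gradient Ω w) (H10.gradient Ω u) +
        inner ℂ (H10.gradient Ω w) (dampingMul Ω ω d (H10.gradient Ω v)) =
          -inner ℂ (H10.toL2 Ω w) h := by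
  have hae : (H10.gradient Ω u + dampingMul Ω ω d (H10.gradient Ω v) : L2Vec Ω)
      =ᵐ[volume.restrict (Ω : Set (EuclideanSpace ℝ (Fin n)))]
      fun x => H10.gradient Ω u x + (damping ω d x : ℂ) • H10.gradient Ω v x := by
    filter_upwards [Lp.coeFn_add (H10.gradient Ω u) (dampingMul Ω ω d (H10.gradient Ω v)),
      coeFn_dampingMul ω d (H10.gradient Ω v)] with x h1 h2
    rw [h1, Pi.add_apply, h2]
  simp only [← inner_add_right]
  rw [← hasWeakDivergence_iff]
  exact ⟨fun hd => hd.congr hae .rfl, fun hd => hd.congr hae.symm .rfl⟩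

/-! ### Dissipativity and the range condition in the energy space -/

section Generation

variable [Fact (2 ≤ n)] [Fact (Bornology.IsBounded (Ω : Set (EuclideanSpace ℝ (Fin n))))]

/-- By Poincaré, a Cauchy sequence for the gradient norm is Cauchy in `L²` too, and the closed graph
contains the limit pair. -/
instance : CompleteSpace (H10 Ω) := by
  refine Metric.complete_of_cauchySeq_tendsto fun u hu => ?_
  obtain ⟨C, hC⟩ := H10.exists_poincare (Ω := Ω)
  have h1 : LipschitzWith 1 (H10.gradient Ω) :=
    LipschitzWith.of_dist_le_mul fun v w => by
      rw [dist_eq_norm, ← map_sub, NNReal.coe_one, one_mul, dist_eq_norm]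
      rfl
  have h2 : LipschitzWith C (H10.toL2 Ω) :=
    LipschitzWith.of_dist_le_mul fun v w => by
      rw [dist_eq_norm, ← map_sub, dist_eq_norm]
      exact hC _
  obtain ⟨g, hg⟩ := cauchySeq_tendsto_of_complete (h1.uniformContinuous.comp_cauchySeq hu)
  obtain ⟨f, hf⟩ := cauchySeq_tendsto_of_complete (h2.uniformContinuous.comp_cauchySeq hu)
  have hmem : (f, g) ∈ (testGraph Ω).topologicalClosure :=
    (testGraph Ω).isClosed_topologicalClosure.mem_of_tendsto (hf.prodMk_nhds hg)
      (Eventually.of_forall fun k => (u k).2)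
  let w : H10 Ω := ⟨(f, g), hmem⟩
  refine ⟨w, ?_⟩
  rw [tendsto_iff_norm_sub_tendsto_zero]
  refine (tendsto_iff_norm_sub_tendsto_zero.1 hg).congr fun k => ?_
  change ‖H10.gradient Ω (u k) - H10.gradient Ω w‖ = ‖H10.gradient Ω (u k - w)‖
  rw [map_sub]

variable (Ω) in
/-- The continuous inclusion `H¹₀(Ω) → L²(Ω)`. -/
noncomputable def H10.toL2CLM : H10 Ω →L[ℂ] L2 Ω :=
  (H10.toL2 Ω).mkContinuousOfExistsBound
    (H10.exists_poincare.elim fun C hC => ⟨C, hC⟩)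

variable (Ω) in
/-- The isometric gradient `H¹₀(Ω) → L²(Ω)ⁿ`. -/
noncomputable def H10.gradientCLM : H10 Ω →L[ℂ] L2Vec Ω :=
  (H10.gradient Ω).mkContinuous 1 fun _ => by
    rw [one_mul]
    rfl

lemma H10.inner_gradient (u v : H10 Ω) :
    inner ℂ (H10.gradient Ω u) (H10.gradient Ω v) = inner ℂ u v :=
  rfl

/-- The weak form of `l² v - Δ v - l div(a ∇v) = l g + Δ f`, divided by `l`, is solvable. -/
lemma exists_weak_solution (ω : Opens (EuclideanSpace ℝ (Fin n))) {d : ℝ} (hd : 0 ≤ d) {l : ℝ}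
    (hl : 0 < l) (f : H10 Ω) (g : L2 Ω) :
    ∃ v : H10 Ω, ∀ w : H10 Ω,
      (l : ℂ) * inner ℂ (H10.toL2 Ω w) (H10.toL2 Ω v) + (l : ℂ)⁻¹ * inner ℂ w v +
        inner ℂ (H10.gradient Ω w) (dampingMul Ω ω d (H10.gradient Ω v)) =
      inner ℂ (H10.toL2 Ω w) g - (l : ℂ)⁻¹ * inner ℂ w f := by
  set J := H10.toL2CLM Ω
  set G := H10.gradientCLM Ω
  let B : H10 Ω →L[ℂ] H10 Ω := (l : ℂ) • (J.adjoint ∘L J) + (l : ℂ)⁻¹ • .id ℂ (H10 Ω) +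
    G.adjoint ∘L dampingMul Ω ω d ∘L G
  have hBapply : ∀ w v : H10 Ω, inner ℂ w (B v) =
      (l : ℂ) * inner ℂ (H10.toL2 Ω w) (H10.toL2 Ω v) + (l : ℂ)⁻¹ * inner ℂ w v +
        inner ℂ (H10.gradient Ω w) (dampingMul Ω ω d (H10.gradient Ω v)) := by
    intro w v
    have h : B v = (l : ℂ) • J.adjoint (J v) + (l : ℂ)⁻¹ • v +
      G.adjoint (dampingMul Ω ω d (G v)) := rfl
    rw [h, inner_add_right, inner_add_right, inner_smul_right, inner_smul_right,
      ContinuousLinearMap.adjoint_inner_right, ContinuousLinearMap.adjoint_inner_right]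
    rfl
  -- The Dirichlet term alone gives the constant `l⁻¹`, as `‖v‖` is the gradient norm; the mass and
  -- damping terms have nonnegative real part.
  have hco : ∀ v, l⁻¹ * ‖v‖ ^ 2 ≤ (inner ℂ v (B v)).re := by
    intro v
    rw [hBapply, Complex.add_re, Complex.add_re, ← Complex.ofReal_inv, Complex.re_ofReal_mul,
      Complex.re_ofReal_mul]
    have h1 := re_inner_dampingMul_nonneg ω hd (H10.gradient Ω v)
    have h2 : 0 ≤ (inner ℂ (H10.toL2 Ω v) (H10.toL2 Ω v)).re :=
      inner_self_nonneg (𝕜 := ℂ)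
    have h3 : ‖v‖ ^ 2 = (inner ℂ v v).re := norm_sq_eq_re_inner (𝕜 := ℂ) v
    rw [h3]
    have := mul_nonneg hl.le h2
    linarith
  obtain ⟨v, hv⟩ := surjective_of_coercive B (inv_pos.2 hl) hco (J.adjoint g - (l : ℂ)⁻¹ • f)
  refine ⟨v, fun w => ?_⟩
  rw [← hBapply, hv, inner_sub_right, inner_smul_right, ContinuousLinearMap.adjoint_inner_right]
  rfl

lemma isMaximalDissipative_operator (ω : Opens (EuclideanSpace ℝ (Fin n))) {d : ℝ} (hd : 0 ≤ d) :
    IsMaximalDissipative (operator Ω ω d).graph where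
  re_inner_nonpos p hp := by
    rw [operator_graph] at hp
    obtain ⟨h1, h2⟩ := hp
    -- Testing with the velocity `v` itself yields the energy identity.
    have h3 := (isLaplacianAddDiv_iff ω d _ _ _).1 h2 p.2.fst
    rw [h1, H10.inner_gradient] at h3
    have h4 := congrArg Complex.re h3
    rw [Complex.add_re, Complex.neg_re] at h4
    have h5 := re_inner_dampingMul_nonneg ω hd (H10.gradient Ω p.2.fst)
    have h6 : (inner ℂ p.2.snd p.1.snd).re = (inner ℂ p.1.snd p.2.snd).re :=
      inner_re_symm (𝕜 := ℂ) _ _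
    have h7 : inner ℂ p.2 p.1 = inner ℂ p.2.fst p.1.fst + inner ℂ p.2.snd p.1.snd := rfl
    rw [h7, Complex.add_re, h6]
    linarith
  eq_zero_of_mem y hy := LinearPMap.graph_fst_eq_zero_snd _ hy rfl
  exists_resolvent l hl z := by
    obtain ⟨v, hv⟩ := exists_weak_solution ω hd hl z.fst z.snd
    have hl' : (l : ℂ) ≠ 0 := by exact_mod_cast hl.ne'
    -- The first component is forced by `l u - v = f`.
    let x : EnergySpace Ω := WithLp.toLp 2 ((l : ℂ)⁻¹ • (v + z.fst), H10.toL2 Ω v)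
    have hx : ((l : ℂ) • x - z).fst = v := by
      change (l : ℂ) • (l : ℂ)⁻¹ • (v + z.fst) - z.fst = v
      rw [smul_smul, mul_inv_cancel₀ hl', one_smul, add_sub_cancel_right]
    refine ⟨x, ?_⟩
    rw [operator_graph]
    refine ⟨congrArg (H10.toL2 Ω) hx, ?_⟩
    change IsLaplacianAddDiv (damping ω d) x.fst ((l : ℂ) • x - z).fst ((l : ℂ) • x - z).snd
    rw [hx, isLaplacianAddDiv_iff]
    intro w
    change inner ℂ w ((l : ℂ)⁻¹ • (v + z.fst)) + _ =
      -inner ℂ (H10.toL2 Ω w) ((l : ℂ) • H10.toL2 Ω v - z.snd)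
    rw [inner_smul_right, inner_add_right, inner_sub_right, inner_smul_right]
    linear_combination hv w

end Generation

end KelvinVoigt

theorem mainTheorem7 (n : ℕ) [Fact (2 ≤ n)]
    (Ω : TopologicalSpace.Opens (EuclideanSpace ℝ (Fin n)))
    [Fact (Bornology.IsBounded (Ω : Set (EuclideanSpace ℝ (Fin n))))]
    (ω : TopologicalSpace.Opens (EuclideanSpace ℝ (Fin n))) (hω : ω ≤ Ω)
    (d : ℝ) (hd : 0 < d) :
    KelvinVoigt.GeneratesContractionC0Semigroup (KelvinVoigt.operator Ω ω d) :=
  (KelvinVoigt.isMaximalDissipative_operator ω hd.le).generatesContractionC0Semigroup
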